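/- Let $d\ge0$ and $M\ge1$ be integers, let $T>0$ and $\alpha\in\mathbb R$, and let $(x^{(m)},y^{(m)})\in\mathbb R^d\times\mathbb R$, $1\le m\le M$, be a fixed data set with empirical law $\pi=\frac1M\sum_{m=1}^M\delta_{(x^{(m)},y^{(m)})}$. Let $\sigma\in C^2_b(\mathbb R)$, i.e. $\sigma$ is twice continuously differentiable and $\sigma,\sigma',\sigma''$ are bounded. Let $\mu_0$ be a probability measure on $\mathbb R^{1+d}\ni(c,w)$ such that $c$ is bounded $\mu_0$-a.s., $\int\|w\|\,d\mu_0<\infty$, and $\int c\,\sigma(w\cdot x^{(m)})\,d\mu_0=0$ for every $m$ (this holds in particular if, under $\mu_0$, $c$ and $w$ are independent and $c$ has mean zero). Let $(C_0^i,W_0^i)_{i\ge1}$ be i.i.d. with law $\mu_0$ and let $(x_k,y_k)_{k\ge0}$ be i.i.d. with law $\pi$, the two sequences being independent of each other. For $N\ge1$ put $g^N_k(x)=\frac1{\sqrt N}\sum_{i=1}^N C^i_k\,\sigma(W^i_k\cdot x)$, where, with learning rate $\alpha/N$, $$C^i_{k+1}=C^i_k+\frac{\alpha}{N^{3/2}}\bigl(y_k-g^N_k(x_k)\bigr)\sigma(W^i_k\cdot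 x_k),\qquad W^i_{k+1}=W^i_k+\frac{\alpha}{N^{3/2}}\bigl(y_k-g^N_k(x_k)\bigr)C^i_k\,\sigma'(W^i_k\cdot x_k)\,x_k .$$ For $t\in[0,T]$ let $\mu^N_t=\frac1N\sum_{i=1}^N\delta_{(C^i_{\lfloor Nt\rfloor},W^i_{\lfloor Nt\rfloor})}$ and $h^N_t=\bigl(g^N_{\lfloor Nt\rfloor}(x^{(1)}),\dots,g^N_{\lfloor Nt\rfloor}(x^{(M)})\bigr)$. Let $E=\mathcal M(\mathbb R^{1+d})\times\mathbb R^M$, where $\mathcal M$ denotes the probability measures with the topology of weak convergence (Prokhorov metric), and let $D_E([0,T])$ be the space of càdlàg paths $[0,T]\to E$ with the Skorokhod ($J_1$) topology. The matrix $\bigl(\int c^2\sigma(w\cdot x^{(m)})\sigma(w\cdot x^{(m')})\,d\mu_0\bigr)_{m,m'}$ is positive semidefinite. Let $\mathcal G$ be any random vector in $\mathbb R^M$ that is centred Gaussian with this covariance matrix. Then: 1. $\bigl(g^N_0(x^{(1)}),\dots,g^N_0(x^{(M)})\bigr)\to\mathcal G$ in distribution as $N\to\infty$. 2. For every realization of $\mathcal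 G$ there is exactly one path $(\mu,h)\in D_E([0,T])$ such that for all $f\in C^2_b(\mathbb R^{1+d})$, $t\in[0,T]$ and $x\in\{x^{(1)},\dots,x^{(M)}\}$ $$\langle f,\mu_t\rangle=\langle f,\mu_0\rangle,\qquad h_t(x)=\mathcal G(x)+\alpha\int_0^t\!\int\bigl(y-h_s(x')\bigr)\Bigl(\langle\sigma(w\cdot x)\sigma(w\cdot x'),\mu_s\rangle+\langle c^2\sigma'(w\cdot x')\sigma'(w\cdot x)\,x^\top x',\mu_s\rangle\Bigr)\pi(dx',dy)\,ds ,$$ where $\mu_0$ on the right of the first equation is the given law, and $\mathcal G$ and $h_t$ are indexed by the data points (so that $\mathcal G(x^{(m)})=\mathcal G_m$, $h_t(x^{(m)})=h_{t,m}$). This path satisfies $\mu_t=\mu_0$ for all $t\in[0,T]$, $h_0=\mathcal G$, and the linear random ODE $dh_t=A(\hat Y-h_t)\,dt$ on $[0,T]$, where $\hat Y=(y^{(1)},\dots,y^{(M)})$ and $$A_{m,m'}=\frac{\alpha}{M}\Bigl(\bigl\langle\sigma(w\cdot x^{(m)})\sigma(w\cdot x^{(m')}),\mu_0\bigr\rangle+\bigl\langle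 c^2\sigma'(w\cdot x^{(m')})\sigma'(w\cdot x^{(m)})\,x^{(m)\top}x^{(m')},\mu_0\bigr\rangle\Bigr).$$ 3. As $N\to\infty$, the process $(\mu^N_t,h^N_t)_{0\le t\le T}$ converges in distribution in $D_E([0,T])$ to this random path $(\mu_t,h_t)_{0\le t\le T}$. -/

import Mathlib

open MeasureTheory ProbabilityTheory Filter Topology
open scoped ENNReal RealInnerProductSpace

noncomputable section

/-! ### Càdlàg paths and the Skorokhod space -/

/-- A path is càdlàg: right-continuous with left limits at every point of `[0, T]`.
(At `0` the filter `𝓝[<] t` is trivial, at `T` right-continuity is void.) -/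
def IsCadlag {T : ℝ} {E : Type*} [TopologicalSpace E] (f : Set.Icc (0 : ℝ) T → E) : Prop :=
  ∀ t, ContinuousWithinAt f (Set.Ici t) t ∧ ∃ l, Tendsto f (𝓝[<] t) (𝓝 l)

/-- The space `D_E([0, T])` of càdlàg paths `[0, T] → E`. -/
@[ext]
structure SkorokhodSpace (T : ℝ) (E : Type*) [TopologicalSpace E] where
  /-- the underlying path -/
  toFun : Set.Icc (0 : ℝ) T → E
  cadlag : IsCadlag toFun

namespace SkorokhodSpace

/-- The Skorokhod (J1) distance: the infimum over all increasing bijections `τ` of `[0, T]` of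
`max (sup_t |τ t - t|) (sup_t d (f (τ t), g t))`. -/
instance {T : ℝ} {E : Type*} [PseudoEMetricSpace E] : EDist (SkorokhodSpace T E) where
  edist f g := ⨅ τ : Set.Icc (0 : ℝ) T ≃o Set.Icc (0 : ℝ) T,
    (⨆ t, edist (τ t) t) ⊔ (⨆ t, edist (f.toFun (τ t)) (g.toFun t))

theorem edist_def {T : ℝ} {E : Type*} [PseudoEMetricSpace E] (f g : SkorokhodSpace T E) :
    edist f g = ⨅ τ : Set.Icc (0 : ℝ) T ≃o Set.Icc (0 : ℝ) T,
      (⨆ t, edist (τ t) t) ⊔ (⨆ t, edist (f.toFun (τ t)) (g.toFun t)) := rfl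

theorem edist_comm_le {T : ℝ} {E : Type*} [PseudoEMetricSpace E] (f g : SkorokhodSpace T E) :
    edist f g ≤ edist g f := by
  rw [edist_def g f]
  refine le_iInf fun τ => ?_
  rw [edist_def]
  refine iInf_le_of_le τ.symm (max_le_max ?_ ?_)
  · refine iSup_le fun t => ?_
    refine le_trans ?_ (le_iSup _ (τ.symm t))
    rw [OrderIso.apply_symm_apply, edist_comm]
  · refine iSup_le fun t => ?_
    refine le_trans ?_ (le_iSup _ (τ.symm t))
    rw [OrderIso.apply_symm_apply, edist_comm]

/-- `D_E([0, T])` with the Skorokhod distance; its topology is the Skorokhod topology. -/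
instance {T : ℝ} {E : Type*} [PseudoEMetricSpace E] :
    PseudoEMetricSpace (SkorokhodSpace T E) where
  edist_self f := by
    rw [edist_def]
    refine le_antisymm (iInf_le_of_le (OrderIso.refl _) ?_) bot_le
    simp
  edist_comm f g := le_antisymm (edist_comm_le f g) (edist_comm_le g f)
  edist_triangle f g h := by
    rw [edist_def f g, edist_def g h, ENNReal.iInf_add]
    refine le_iInf fun τ₁ => ?_
    rw [ENNReal.add_iInf]
    refine le_iInf fun τ₂ => ?_
    rw [edist_def]
    refine iInf_le_of_le (τ₂.trans τ₁) (max_le ?_ ?_)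
    · refine iSup_le fun t => (edist_triangle _ (τ₂ t) _).trans (add_le_add ?_ ?_)
      · exact le_trans (le_iSup (fun s => edist (τ₁ s) s) (τ₂ t)) le_sup_left
      · exact le_trans (le_iSup (fun s => edist (τ₂ s) s) t) le_sup_left
    · refine iSup_le fun t => (edist_triangle _ (g.toFun (τ₂ t)) _).trans (add_le_add ?_ ?_)
      · exact le_trans (le_iSup (fun s => edist (f.toFun (τ₁ s)) (g.toFun s)) (τ₂ t)) le_sup_right
      · exact le_trans (le_iSup (fun s => edist (g.toFun (τ₂ s)) (h.toFun s)) t) le_sup_right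

/-- The Borel σ-algebra of the Skorokhod topology. -/
instance {T : ℝ} {E : Type*} [PseudoEMetricSpace E] : MeasurableSpace (SkorokhodSpace T E) :=
  borel _

instance {T : ℝ} {E : Type*} [PseudoEMetricSpace E] : BorelSpace (SkorokhodSpace T E) := ⟨rfl⟩

/-- The value at a real time `t`, for `t ∈ [0, T]` (constant continuation outside `[0, T]`). -/
def eval {T : ℝ} {E : Type*} [TopologicalSpace E] (hT : 0 ≤ T) (z : SkorokhodSpace T E) (t : ℝ) :
    E :=
  z.toFun (Set.projIcc 0 T hT t)

end SkorokhodSpace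

theorem isCadlag_floor {T : ℝ} {E : Type*} [TopologicalSpace E] (a : ℕ → E) (N : ℕ) :
    IsCadlag (fun t : Set.Icc (0 : ℝ) T => a ⌊(N : ℝ) * (t : ℝ)⌋₊) := by
  intro t
  have hcont : Continuous fun s : Set.Icc (0 : ℝ) T => (N : ℝ) * (s : ℝ) := by fun_prop
  have hmono : ∀ {r s : Set.Icc (0 : ℝ) T}, r ≤ s → (N : ℝ) * (r : ℝ) ≤ (N : ℝ) * (s : ℝ) :=
    fun h => mul_le_mul_of_nonneg_left h (Nat.cast_nonneg N)
  constructor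
  · have h1 : ∀ᶠ s : Set.Icc (0 : ℝ) T in 𝓝[≥] t,
        a ⌊(N : ℝ) * (s : ℝ)⌋₊ = a ⌊(N : ℝ) * (t : ℝ)⌋₊ := by
      have h2 : ∀ᶠ s : Set.Icc (0 : ℝ) T in 𝓝 t,
          (N : ℝ) * (s : ℝ) < ⌊(N : ℝ) * (t : ℝ)⌋₊ + 1 :=
        hcont.continuousAt.eventually_lt continuousAt_const (Nat.lt_floor_add_one _)
      filter_upwards [nhdsWithin_le_nhds h2, self_mem_nhdsWithin] with s hs hts
      congr 1
      have h0 : (0 : ℝ) ≤ (N : ℝ) * (t : ℝ) := mul_nonneg (Nat.cast_nonneg N) t.2.1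
      have hst := hmono hts
      exact (Nat.floor_eq_iff (h0.trans hst)).2 ⟨(Nat.floor_le h0).trans hst, hs⟩
    exact tendsto_const_nhds.congr' (h1.mono fun _ h => h.symm)
  · rcases Nat.eq_zero_or_pos N with rfl | hN
    · exact ⟨a 0, by simpa using tendsto_const_nhds⟩
    refine ⟨a (⌈(N : ℝ) * (t : ℝ)⌉₊ - 1), ?_⟩
    have h1 : ∀ᶠ s : Set.Icc (0 : ℝ) T in 𝓝[<] t,
        a ⌊(N : ℝ) * (s : ℝ)⌋₊ = a (⌈(N : ℝ) * (t : ℝ)⌉₊ - 1) := by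
      have h2 : ∀ᶠ s : Set.Icc (0 : ℝ) T in 𝓝 t,
          (⌈(N : ℝ) * (t : ℝ)⌉₊ : ℝ) - 1 < (N : ℝ) * (s : ℝ) := by
        refine continuousAt_const.eventually_lt hcont.continuousAt ?_
        have := Nat.ceil_lt_add_one
          (mul_nonneg (Nat.cast_nonneg N) t.2.1 : (0 : ℝ) ≤ (N : ℝ) * (t : ℝ))
        linarith
      filter_upwards [nhdsWithin_le_nhds h2, self_mem_nhdsWithin] with s hs hts
      have hst : (N : ℝ) * (s : ℝ) < (N : ℝ) * (t : ℝ) :=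
        mul_lt_mul_of_pos_left hts (Nat.cast_pos.2 hN)
      have h0 : (0 : ℝ) ≤ (N : ℝ) * (s : ℝ) := mul_nonneg (Nat.cast_nonneg N) s.2.1
      congr 1
      have hpos : 1 ≤ ⌈(N : ℝ) * (t : ℝ)⌉₊ := Nat.ceil_pos.2 (h0.trans_lt hst)
      refine (Nat.floor_eq_iff h0).2 ⟨?_, ?_⟩
      · push_cast [Nat.cast_sub hpos]
        exact hs.le
      · push_cast [Nat.cast_sub hpos]
        have := Nat.le_ceil ((N : ℝ) * (t : ℝ))
        linarith
    exact tendsto_const_nhds.congr' (h1.mono fun _ h => h.symm)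

/-! ### The network and its training -/

/-- `C²_b`: twice continuously differentiable, the function and its derivatives up to order two
being bounded. -/
def IsCb2 {V : Type*} [NormedAddCommGroup V] [NormedSpace ℝ V] (f : V → ℝ) : Prop :=
  ContDiff ℝ 2 f ∧ ∃ B : ℝ, ∀ k : ℕ, k ≤ 2 → ∀ v, ‖iteratedFDeriv ℝ k f v‖ ≤ B

/-- The space `ℝ^{1+d}` of the parameters `(c, w)` of one hidden unit. -/
abbrev ParamSpace (d : ℕ) : Type := ℝ × EuclideanSpace ℝ (Fin d)

/-- Output `g^N(x; θ) = N^{-1/2} ∑ᵢ Cⁱ σ(Wⁱ · x)` of the network with `N` hidden units. -/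
def netOutput {d N : ℕ} (σ : ℝ → ℝ) (θ : Fin N → ParamSpace d) (x : EuclideanSpace ℝ (Fin d)) : ℝ :=
  (1 / √(N : ℝ)) * ∑ i, (θ i).1 * σ ⟪(θ i).2, x⟫

/-- One step of stochastic gradient descent with learning rate `lr` on the sample `p = (x, y)`. -/
def sgdStep {d N : ℕ} (σ : ℝ → ℝ) (lr : ℝ) (θ : Fin N → ParamSpace d)
    (p : EuclideanSpace ℝ (Fin d) × ℝ) : Fin N → ParamSpace d := fun i =>
  ((θ i).1 + lr / √(N : ℝ) * (p.2 - netOutput σ θ p.1) * σ ⟪(θ i).2, p.1⟫,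
   (θ i).2 + (lr / √(N : ℝ) * (p.2 - netOutput σ θ p.1) * (θ i).1 * deriv σ ⟪(θ i).2, p.1⟫) • p.1)

/-- The parameters after `k` steps of stochastic gradient descent with learning rate `α / N`,
started from `θ₀` and using the samples `ζ 0, ζ 1, …`. -/
def sgd {d N : ℕ} (σ : ℝ → ℝ) (α : ℝ) (θ₀ : Fin N → ParamSpace d)
    (ζ : ℕ → EuclideanSpace ℝ (Fin d) × ℝ) : ℕ → Fin N → ParamSpace d
  | 0 => θ₀
  | k + 1 => sgdStep σ (α / N) (sgd σ α θ₀ ζ k) (ζ k)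

/-- The vector `(g^N(x⁽¹⁾; θ), …, g^N(x⁽ᴹ⁾; θ))` of the outputs on the data set. -/
def dataOutput {d M N : ℕ} (σ : ℝ → ℝ) (xs : Fin M → EuclideanSpace ℝ (Fin d))
    (θ : Fin N → ParamSpace d) : EuclideanSpace ℝ (Fin M) :=
  WithLp.toLp 2 fun m => netOutput σ θ (xs m)

/-- The empirical measure `N⁻¹ ∑ᵢ δ_{θ i}`. -/
def empiricalMeasure {X : Type*} [MeasurableSpace X] {N : ℕ} [NeZero N] (θ : Fin N → X) :
    ProbabilityMeasure X :=
  ⟨(N : ℝ≥0∞)⁻¹ • ∑ i, Measure.dirac (θ i), ⟨by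
    simp [ENNReal.inv_mul_cancel (Nat.cast_ne_zero.2 (NeZero.ne N)) (ENNReal.natCast_ne_top N)]⟩⟩

/-- The law `π = M⁻¹ ∑ₘ δ_{(x⁽ᵐ⁾, y⁽ᵐ⁾)}` of a data sample. -/
def dataMeasure {d M : ℕ} (xs : Fin M → EuclideanSpace ℝ (Fin d)) (ys : Fin M → ℝ) :
    Measure (EuclideanSpace ℝ (Fin d) × ℝ) :=
  (M : ℝ≥0∞)⁻¹ • ∑ m, Measure.dirac (xs m, ys m)

/-- The state space `E = 𝓜(ℝ^{1+d}) × ℝ^M`, where the space of probability measures carries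
the (Lévy–)Prokhorov metric, i.e. the topology of weak convergence. -/
abbrev StateSpace (d M : ℕ) : Type :=
  LevyProkhorov (ProbabilityMeasure (ParamSpace d)) × EuclideanSpace ℝ (Fin M)

/-- The rescaled path `t ↦ (μ_t^N, h_t^N) = (ν_{⌊Nt⌋}^N, g_{⌊Nt⌋}^N)` as an element of
`D_E([0, T])`. -/
def rescaledPath {d M N : ℕ} [NeZero N] (T : ℝ) (σ : ℝ → ℝ) (α : ℝ)
    (xs : Fin M → EuclideanSpace ℝ (Fin d)) (θ₀ : Fin N → ParamSpace d)
    (ζ : ℕ → EuclideanSpace ℝ (Fin d) × ℝ) : SkorokhodSpace T (StateSpace d M) where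
  toFun t := (LevyProkhorov.ofMeasure (empiricalMeasure (sgd σ α θ₀ ζ ⌊(N : ℝ) * (t : ℝ)⌋₊)),
    dataOutput σ xs (sgd σ α θ₀ ζ ⌊(N : ℝ) * (t : ℝ)⌋₊))
  cadlag := isCadlag_floor (fun k => ((LevyProkhorov.ofMeasure (empiricalMeasure (sgd σ α θ₀ ζ k)),
    dataOutput σ xs (sgd σ α θ₀ ζ k)) : StateSpace d M)) N

/-! ### The limit -/

/-- `⟨σ(w · x) σ(w · x'), μ⟩ + ⟨c² σ'(w · x') σ'(w · x) xᵀ x', μ⟩`. -/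
def limitKernel {d : ℕ} (σ : ℝ → ℝ) (μ : Measure (ParamSpace d))
    (x x' : EuclideanSpace ℝ (Fin d)) : ℝ :=
  (∫ p, σ ⟪p.2, x⟫ * σ ⟪p.2, x'⟫ ∂μ) +
    ∫ p, p.1 ^ 2 * deriv σ ⟪p.2, x'⟫ * deriv σ ⟪p.2, x⟫ * ⟪x, x'⟫ ∂μ

/-- The matrix `A`, with entries `α / M` times the kernel at the data points. -/
def limitMatrix {d M : ℕ} (σ : ℝ → ℝ) (α : ℝ) (μ : Measure (ParamSpace d))
    (xs : Fin M → EuclideanSpace ℝ (Fin d)) : Matrix (Fin M) (Fin M) ℝ :=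
  Matrix.of fun m m' => α / M * limitKernel σ μ (xs m) (xs m')

/-- The covariance matrix `⟨c² σ(w · x⁽ᵐ⁾) σ(w · x⁽ᵐ'⁾), μ⟩` of the limit of the initial outputs. -/
def initialCovariance {d M : ℕ} (σ : ℝ → ℝ) (μ : Measure (ParamSpace d))
    (xs : Fin M → EuclideanSpace ℝ (Fin d)) : Matrix (Fin M) (Fin M) ℝ :=
  Matrix.of fun m m' => ∫ p, p.1 ^ 2 * σ ⟪p.2, xs m⟫ * σ ⟪p.2, xs m'⟫ ∂μ

/-- The path `z = (μ, h)` solves the limit equations with initial values `μ₀` and `g`: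
`⟨f, μ_t⟩ = ⟨f, μ₀⟩` for all `f ∈ C²_b(ℝ^{1+d})`, and `h_t` satisfies the integral equation driven by
the kernel at `μ_s`, the integral over `π(dx', dy)` being the mean over the data points. -/
def IsLimitSolution {d M : ℕ} {T : ℝ} (hT : 0 ≤ T) (σ : ℝ → ℝ) (α : ℝ)
    (xs : Fin M → EuclideanSpace ℝ (Fin d)) (ys : Fin M → ℝ)
    (μ₀ : ProbabilityMeasure (ParamSpace d)) (g : EuclideanSpace ℝ (Fin M))
    (z : SkorokhodSpace T (StateSpace d M)) : Prop :=
  (∀ f : ParamSpace d → ℝ, IsCb2 f → ∀ t ∈ Set.Icc (0 : ℝ) T,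
    ∫ p, f p ∂((z.eval hT t).1.toMeasure : Measure (ParamSpace d)) =
      ∫ p, f p ∂(μ₀ : Measure (ParamSpace d))) ∧
  ∀ t ∈ Set.Icc (0 : ℝ) T, ∀ m : Fin M,
    (z.eval hT t).2 m = g m + α * ∫ s in (0 : ℝ)..t, (1 / (M : ℝ)) * ∑ m' : Fin M,
      (ys m' - (z.eval hT s).2 m') *
        limitKernel σ ((z.eval hT s).1.toMeasure : Measure (ParamSpace d)) (xs m) (xs m')

end

/-! ### Functions of class `C²_b` -/

/-! In this scaling one gradient step moves a hidden unit by O(N^{-3/2}), so during the NT steps up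
to time T no unit moves by more than O(N^{-1/2}). Hence the empirical measure stays close, in the
Lévy–Prokhorov metric, to its initial value, which tends to `μ₀` almost surely, and the empirical
tangent kernel stays close to its initial value, which converges by the strong law. A Taylor
expansion turns training into a recursion for the outputs on the data: a step of size 1/N along the
drift of the sampled data point, up to errors of smaller order. To replace that drift by its mean
over the data it suffices that the empirical frequencies of the data points converge, because the
outputs vary slowly and summation by parts absorbs the fluctuations. The outputs therefore follow
the linear flow of the limit equation.

The comparison is pathwise, and the flow is started from the actual initial output g^N_0 rather than
from the Gaussian vector. Almost surely, for each fixed R, the distance is eventually small for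
those N with ‖g^N_0‖ ≤ R (`exists_sgd_bounds`, `norm_sub_le_of_averaging`,
`exists_dataOutput_sub_linearFlow_le`, `eventually_edist_limitPath_rescaledPath_le`). The only
genuine limit in law is the central limit theorem for g^N_0
(`tendstoInDistribution_multivariate_clt`). Since `limitPath` depends continuously on its starting
point, the continuous mapping theorem and Slutsky's lemma
(`tendstoInDistribution_of_tendsto_measure_edist`) carry that limit to the paths, so no tightness
argument on path space is needed.

For uniqueness, C²_b test functions determine a measure, so the first equation freezes μ_t at `μ₀`;
what remains is a linear ODE in integral form. -/

theorem IsCb2.exists_bounds {σ : ℝ → ℝ} (hσ : IsCb2 σ) :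
    ∃ B : ℝ, 0 ≤ B ∧ Differentiable ℝ σ ∧ Continuous (deriv σ) ∧ (∀ x, |σ x| ≤ B) ∧
      (∀ x, |deriv σ x| ≤ B) ∧ (∀ x y, |σ x - σ y| ≤ B * |x - y|) ∧
      (∀ x y, |deriv σ x - deriv σ y| ≤ B * |x - y|) := by
  obtain ⟨h2, B, hB⟩ := hσ
  have hd : Differentiable ℝ σ := h2.differentiable (by norm_num)
  have h1 : ContDiff ℝ 1 (deriv σ) :=
    ((contDiff_succ_iff_deriv (n := 1)).1 (by simpa [one_add_one_eq_two] using h2)).2.2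
  have hd1 : Differentiable ℝ (deriv σ) := h1.differentiable (by norm_num)
  have b0 : ∀ x, |σ x| ≤ B := fun x => by simpa using hB 0 (by norm_num) x
  have b1 : ∀ x, |deriv σ x| ≤ B := fun x => by
    have := hB 1 (by norm_num) x
    rwa [norm_iteratedFDeriv_eq_norm_iteratedDeriv, iteratedDeriv_one] at this
  have b2 : ∀ x, |deriv (deriv σ) x| ≤ B := fun x => by
    have := hB 2 le_rfl x
    rwa [norm_iteratedFDeriv_eq_norm_iteratedDeriv, iteratedDeriv_succ, iteratedDeriv_one] at this
  refine ⟨B, (abs_nonneg _).trans (b0 0), hd, h1.continuous, b0, b1, fun x y => ?_, fun x y => ?_⟩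
  · exact Convex.norm_image_sub_le_of_norm_deriv_le (fun x _ => hd x) (fun x _ => b1 x)
      convex_univ (Set.mem_univ y) (Set.mem_univ x)
  · exact Convex.norm_image_sub_le_of_norm_deriv_le (fun x _ => hd1 x) (fun x _ => b2 x)
      convex_univ (Set.mem_univ y) (Set.mem_univ x)

/-- Mean value inequality for σ minus its tangent line at x, whose derivative is at most B|y - x|
between x and y. -/
theorem abs_sub_sub_deriv_mul_le {σ : ℝ → ℝ} {B : ℝ} (hd : Differentiable ℝ σ)
    (hL : ∀ x y, |deriv σ x - deriv σ y| ≤ B * |x - y|) (hB : 0 ≤ B) (x y : ℝ) :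
    |σ y - σ x - deriv σ x * (y - x)| ≤ B * |y - x| ^ 2 := by
  have key := Convex.norm_image_sub_le_of_norm_hasDerivWithin_le
    (f := fun z => σ z - deriv σ x * z) (f' := fun z => deriv σ z - deriv σ x)
    (s := Set.uIcc x y) (C := B * |y - x|) (x := x) (y := y) ?_ ?_ (convex_uIcc x y)
    Set.left_mem_uIcc Set.right_mem_uIcc
  · calc |σ y - σ x - deriv σ x * (y - x)|
        = ‖(σ y - deriv σ x * y) - (σ x - deriv σ x * x)‖ := by
          rw [Real.norm_eq_abs]; ring_nf
      _ ≤ B * |y - x| * ‖y - x‖ := key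
      _ = B * |y - x| ^ 2 := by rw [Real.norm_eq_abs]; ring
  · intro z _
    have h1 := (hd z).hasDerivAt.fun_sub ((hasDerivAt_id z).const_mul (deriv σ x))
    simpa using h1.hasDerivWithinAt
  · intro z hz
    refine (hL z x).trans (mul_le_mul_of_nonneg_left ?_ hB)
    exact Set.abs_sub_left_of_mem_uIcc hz

/-! ### Summation by parts and an averaging principle -/

/-- Abel summation: with W_k the partial sums of w, the sum equals W_k b_k minus the sum of W_{j+1}
(b_{j+1} - b_j) over j < k. Small partial sums and a slowly varying b thus suffice, with no bound on
the single weights. -/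
theorem norm_sum_smul_le_of_partial_sums {V : Type*} [NormedAddCommGroup V] [NormedSpace ℝ V]
    (w : ℕ → ℝ) (b : ℕ → V) {n : ℕ} {s B c : ℝ}
    (hs : ∀ k ≤ n, |∑ j ∈ Finset.range k, w j| ≤ s) (hb : ∀ k ≤ n, ‖b k‖ ≤ B)
    (hc : ∀ k < n, ‖b (k + 1) - b k‖ ≤ c) {k : ℕ} (hk : k ≤ n) :
    ‖∑ j ∈ Finset.range k, w j • b j‖ ≤ s * B + k * (s * c) := by
  have hs0 : 0 ≤ s := (abs_nonneg _).trans (hs 0 (Nat.zero_le _))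
  have hT : ∀ k ≤ n, ‖∑ j ∈ Finset.range k, w j • b j - (∑ j ∈ Finset.range k, w j) • b k‖ ≤
      k * (s * c) := by
    intro k
    induction k with
    | zero => simp
    | succ k ih =>
      intro hk
      have e : ∑ j ∈ Finset.range (k + 1), w j • b j
          - (∑ j ∈ Finset.range (k + 1), w j) • b (k + 1)
          = (∑ j ∈ Finset.range k, w j • b j - (∑ j ∈ Finset.range k, w j) • b k)
            - (∑ j ∈ Finset.range (k + 1), w j) • (b (k + 1) - b k) := by
        rw [Finset.sum_range_succ, Finset.sum_range_succ]
        module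
      rw [e]
      refine (norm_sub_le _ _).trans ?_
      rw [norm_smul, Real.norm_eq_abs]
      have h1 := ih (by omega)
      have h2 : |∑ j ∈ Finset.range (k + 1), w j| * ‖b (k + 1) - b k‖ ≤ s * c :=
        mul_le_mul (hs _ hk) (hc k (by omega)) (norm_nonneg _) hs0
      push_cast
      linarith
  have h1 := hT k hk
  have h2 : ‖(∑ j ∈ Finset.range k, w j) • b k‖ ≤ s * B := by
    rw [norm_smul, Real.norm_eq_abs]
    exact mul_le_mul (hs _ hk) (hb k hk) (norm_nonneg _) hs0
  calc ‖∑ j ∈ Finset.range k, w j • b j‖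
      = ‖(∑ j ∈ Finset.range k, w j • b j - (∑ j ∈ Finset.range k, w j) • b k)
          + (∑ j ∈ Finset.range k, w j) • b k‖ := by rw [sub_add_cancel]
    _ ≤ _ := (norm_add_le _ _).trans (by linarith)

/-- Discrete Grönwall inequality in integrated form. -/
theorem le_mul_exp_of_le_add_sum {d : ℕ → ℝ} {η a : ℝ} {n : ℕ} (ha : 0 ≤ a) (hη : 0 ≤ η)
    (h : ∀ k ≤ n, d k ≤ η + ∑ j ∈ Finset.range k, a * d j) {k : ℕ} (hk : k ≤ n) :
    d k ≤ η * Real.exp (a * k) := by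
  -- The induction runs on the right-hand side of the hypothesis, since d has no assumed sign or
  -- monotonicity.
  have key : ∀ k ≤ n, η + ∑ j ∈ Finset.range k, a * d j ≤ η * (1 + a) ^ k := by
    intro k
    induction k with
    | zero => simp
    | succ k ih =>
      intro hk
      have h1 := ih (by omega)
      have h2 := h k (by omega)
      rw [Finset.sum_range_succ]
      have h3 : a * d k ≤ a * (η * (1 + a) ^ k) := mul_le_mul_of_nonneg_left (h2.trans h1) ha
      calc _ ≤ η * (1 + a) ^ k + a * (η * (1 + a) ^ k) := by linarith
        _ = _ := by ring
  refine (h k hk).trans ((key k hk).trans (mul_le_mul_of_nonneg_left ?_ hη))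
  calc (1 + a) ^ k ≤ (Real.exp a) ^ k := by
        gcongr
        linarith [Real.add_one_le_exp a]
    _ = Real.exp (a * k) := by rw [← Real.exp_nat_mul, mul_comm]

/-- Averaging principle: a recursion driven by rapidly varying weights `e` stays close to the
recursion driven by their means `p`, provided that the partial sums of `e - p` are small. -/
theorem norm_sub_le_of_averaging {V ι : Type*} [NormedAddCommGroup V] [NormedSpace ℝ V]
    [Fintype ι] (F : ι → V → V) (u h : ℕ → V) (r r' : ℕ → V) (e : ℕ → ι → ℝ) (p : ι → ℝ)
    {n : ℕ} {a L B c s δ δ' : ℝ} (ha : 0 ≤ a) (hL : 0 ≤ L) (hδ : 0 ≤ δ) (hδ' : 0 ≤ δ')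
    (hB : 0 ≤ B) (hc0 : 0 ≤ c)
    (hp : ∀ m, 0 ≤ p m) (hp1 : ∑ m, p m = 1)
    (hu : ∀ k < n, u (k + 1) = u k + a • ∑ m, e k m • F m (u k) + r k)
    (hh : ∀ k < n, h (k + 1) = h k + a • ∑ m, p m • F m (h k) + r' k)
    (h0 : u 0 = h 0) (hr : ∀ k < n, ‖r k‖ ≤ a * δ) (hr' : ∀ k < n, ‖r' k‖ ≤ a * δ')
    (hF : ∀ m x y, ‖F m x - F m y‖ ≤ L * ‖x - y‖) (hFB : ∀ m, ∀ k ≤ n, ‖F m (u k)‖ ≤ B)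
    (huc : ∀ k < n, ‖u (k + 1) - u k‖ ≤ a * c)
    (hs : ∀ m, ∀ k ≤ n, |∑ j ∈ Finset.range k, (e j m - p m)| ≤ s) {k : ℕ} (hk : k ≤ n) :
    ‖u k - h k‖ ≤ (Fintype.card ι * (a * s * (B + n * a * (L * c))) + n * a * (δ + δ')) *
      Real.exp (L * (n * a)) := by
  have hs0 : ∀ m : ι, 0 ≤ s := fun m => (abs_nonneg _).trans (hs m 0 (Nat.zero_le _))
  -- The sign of s can be read off `hs` only if ι is nonempty; the product is nonnegative in either
  -- case.
  have hs1 : (0 : ℝ) ≤ Fintype.card ι * s := by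
    rcases isEmpty_or_nonempty ι with hι | ⟨⟨m⟩⟩
    · simp
    · exact mul_nonneg (Nat.cast_nonneg _) (hs0 m)
  set η : ℝ := Fintype.card ι * (a * s * (B + n * a * (L * c))) + n * a * (δ + δ') with hηdef
  have hη : 0 ≤ η := by
    have : (Fintype.card ι * (a * s * (B + n * a * (L * c))) : ℝ)
        = (Fintype.card ι * s) * (a * (B + n * a * (L * c))) := by ring
    rw [hηdef, this]
    positivity
  -- Three contributions: the weight fluctuations integrated along u, the remainders, and a
  -- Lipschitz term in u - h. The first is small by summation by parts, because F m (u j) changes by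
  -- at most L a c per step; the last feeds Grönwall.
  have expand : ∀ k ≤ n, u k - h k =
      (a • ∑ m, ∑ j ∈ Finset.range k, (e j m - p m) • F m (u j))
      + (∑ j ∈ Finset.range k, (r j - r' j))
      + ∑ j ∈ Finset.range k, a • ∑ m, p m • (F m (u j) - F m (h j)) := by
    intro k
    induction k with
    | zero => simp [h0]
    | succ k ih =>
      intro hk
      rw [hu k (by omega), hh k (by omega)]
      simp only [Finset.sum_range_succ, Finset.sum_add_distrib, sub_smul, smul_sub, smul_add,
        Finset.sum_sub_distrib] at ih ⊢
      have := ih (by omega)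
      rw [sub_eq_iff_eq_add] at this
      rw [this]
      module
  have bound : ∀ k ≤ n, ‖u k - h k‖ ≤ η + ∑ j ∈ Finset.range k, (a * L) * ‖u j - h j‖ := by
    intro k hk
    have hkn : (k : ℝ) ≤ n := by exact_mod_cast hk
    rw [expand k hk]
    refine (norm_add_le _ _).trans (add_le_add ((norm_add_le _ _).trans (add_le_add ?_ ?_)) ?_)
    · rw [norm_smul, Real.norm_eq_abs, abs_of_nonneg ha]
      have h1 : ∀ m : ι, ‖∑ j ∈ Finset.range k, (e j m - p m) • F m (u j)‖
          ≤ s * B + n * (s * (L * (a * c))) := by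
        intro m
        refine (norm_sum_smul_le_of_partial_sums (n := n) (fun j => e j m - p m)
          (fun j => F m (u j)) (hs m) (hFB m) (c := L * (a * c)) ?_ hk).trans ?_
        · intro i hi
          exact (hF m _ _).trans (mul_le_mul_of_nonneg_left (huc i hi) hL)
        · have := hs0 m
          gcongr
      calc a * ‖∑ m, ∑ j ∈ Finset.range k, (e j m - p m) • F m (u j)‖
          ≤ a * ∑ m : ι, (s * B + n * (s * (L * (a * c)))) := by
            gcongr
            exact norm_sum_le_of_le _ fun m _ => h1 m
        _ = Fintype.card ι * (a * s * (B + n * a * (L * c))) := by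
            simp only [Finset.sum_const, Finset.card_univ, nsmul_eq_mul]
            ring
    · calc ‖∑ j ∈ Finset.range k, (r j - r' j)‖
          ≤ ∑ j ∈ Finset.range k, (a * (δ + δ')) := by
            refine norm_sum_le_of_le _ fun j hj => (norm_sub_le _ _).trans ?_
            have hj' : j < n := (Finset.mem_range.1 hj).trans_le hk
            linarith [hr j hj', hr' j hj']
        _ = k * a * (δ + δ') := by simp; ring
        _ ≤ n * a * (δ + δ') := by gcongr
    · refine norm_sum_le_of_le _ fun j _ => ?_
      rw [norm_smul, Real.norm_eq_abs, abs_of_nonneg ha, mul_assoc]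
      refine mul_le_mul_of_nonneg_left ?_ ha
      calc ‖∑ m, p m • (F m (u j) - F m (h j))‖
          ≤ ∑ m, p m * (L * ‖u j - h j‖) := by
            refine norm_sum_le_of_le _ fun m _ => ?_
            rw [norm_smul, Real.norm_eq_abs, abs_of_nonneg (hp m)]
            exact mul_le_mul_of_nonneg_left (hF m _ _) (hp m)
        _ = L * ‖u j - h j‖ := by rw [← Finset.sum_mul, hp1, one_mul]
  refine (le_mul_exp_of_le_add_sum (mul_nonneg ha hL) hη bound hk).trans ?_
  have hkn : (k : ℝ) ≤ n := by exact_mod_cast hk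
  refine mul_le_mul_of_nonneg_left (Real.exp_le_exp.2 ?_) hη
  calc a * L * k ≤ a * L * n := by gcongr
    _ = _ := by ring

/-- If `a k = o(k)` then `max_{k ≤ n} |a k| = o(n)`. -/
theorem eventually_forall_abs_le_mul {a : ℕ → ℝ}
    (h : Tendsto (fun n : ℕ => (n : ℝ)⁻¹ * a n) atTop (𝓝 0)) {ε : ℝ} (hε : 0 < ε) :
    ∀ᶠ n : ℕ in atTop, ∀ k ≤ n, |a k| ≤ ε * n := by
  obtain ⟨n₀, hn₀⟩ := (Metric.tendsto_atTop.1 h) ε hε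
  -- The cut is at n₀ + 1 so that the remaining k are positive and satisfy |a k| ≤ ε k ≤ ε n; the
  -- finitely many others are below ε n once n is large.
  obtain ⟨C, hC⟩ : ∃ C : ℝ, ∀ k < n₀ + 1, |a k| ≤ C :=
    ⟨∑ k ∈ Finset.range (n₀ + 1), |a k|, fun k hk => Finset.single_le_sum
      (f := fun k => |a k|) (fun _ _ => abs_nonneg _) (Finset.mem_range.2 hk)⟩
  have hlim : Tendsto (fun n : ℕ => ε * (n : ℝ)) atTop atTop :=
    tendsto_natCast_atTop_atTop.const_mul_atTop hε
  filter_upwards [hlim.eventually_ge_atTop C] with n hn k hk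
  rcases lt_or_ge k (n₀ + 1) with hk0 | hk0
  · exact (hC k hk0).trans hn
  · have := hn₀ k (by omega)
    have hk' : (0 : ℝ) < k := by exact_mod_cast (by omega : 0 < k)
    rw [Real.dist_eq, sub_zero, abs_mul, abs_inv, Nat.abs_cast, inv_mul_lt_iff₀ hk'] at this
    have hkn : (k : ℝ) ≤ n := by exact_mod_cast hk
    nlinarith

/-! ### Càdlàg paths -/

theorem IsCadlag.of_continuous {T : ℝ} {E : Type*} [TopologicalSpace E]
    {f : Set.Icc (0 : ℝ) T → E} (hf : Continuous f) : IsCadlag f := fun t =>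
  ⟨hf.continuousWithinAt, f t, hf.continuousAt.tendsto.mono_left nhdsWithin_le_nhds⟩

theorem IsCadlag.comp {T : ℝ} {E F : Type*} [TopologicalSpace E] [TopologicalSpace F]
    {f : Set.Icc (0 : ℝ) T → E} (hf : IsCadlag f) {φ : E → F} (hφ : Continuous φ) :
    IsCadlag (φ ∘ f) := fun t =>
  ⟨hφ.continuousAt.comp_continuousWithinAt (hf t).1,
    let ⟨l, hl⟩ := (hf t).2; ⟨φ l, (hφ.tendsto l).comp hl⟩⟩

/-- The value and the left limit at t bound f on a neighbourhood of t; compactness of [0, T] glues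
these local bounds. -/
theorem IsCadlag.exists_bound {T : ℝ} {f : Set.Icc (0 : ℝ) T → ℝ} (hf : IsCadlag f) :
    ∃ C, ∀ t, |f t| ≤ C := by
  have key : ∃ C, ∀ t ∈ (Set.univ : Set (Set.Icc (0 : ℝ) T)), |f t| ≤ C := by
    refine isCompact_univ.induction_on (p := fun s => ∃ C, ∀ t ∈ s, |f t| ≤ C)
      ⟨0, by simp⟩ (fun s t hst ⟨C, hC⟩ => ⟨C, fun x hx => hC x (hst hx)⟩) ?_ ?_
    · rintro s t ⟨C, hC⟩ ⟨D, hD⟩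
      refine ⟨max C D, ?_⟩
      rintro x (hx | hx)
      · exact (hC x hx).trans (le_max_left _ _)
      · exact (hD x hx).trans (le_max_right _ _)
    · intro t _
      obtain ⟨h1, l, h2⟩ := hf t
      have e1 : ∀ᶠ s in 𝓝[≥] t, |f s| ≤ |f t| + |l| + 1 := by
        have := (h1.tendsto.abs).eventually_le_const
          (u := |f t| + |l| + 1) (by linarith [abs_nonneg l])
        exact this
      have e2 : ∀ᶠ s in 𝓝[<] t, |f s| ≤ |f t| + |l| + 1 :=
        h2.abs.eventually_le_const (by linarith [abs_nonneg (f t)])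
      refine ⟨{s | |f s| ≤ |f t| + |l| + 1}, ?_, _, fun s hs => hs⟩
      rw [nhdsWithin_univ, ← nhdsLT_sup_nhdsGE]
      exact ⟨e2, e1⟩
  exact key.imp fun C h t => h t trivial

theorem SkorokhodSpace.eval_of_mem {T : ℝ} {E : Type*} [TopologicalSpace E] (hT : 0 ≤ T)
    (z : SkorokhodSpace T E) {t : ℝ} (ht : t ∈ Set.Icc 0 T) : z.eval hT t = z.toFun ⟨t, ht⟩ := by
  rw [SkorokhodSpace.eval, Set.projIcc_of_mem hT ht]

/-- By right-continuity the function is the pointwise limit of its values at the grid points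
(⌊(n+1)t⌋ + 1)/(n+1), which lie to the right of t and take countably many values. -/
theorem IsCadlag.measurable_extend {T : ℝ} (hT : 0 ≤ T) {f : Set.Icc (0 : ℝ) T → ℝ}
    (hf : IsCadlag f) : Measurable fun t => f (Set.projIcc 0 T hT t) := by
  set g : ℝ → ℝ := fun t => f (Set.projIcc 0 T hT t) with hg
  have hr : ∀ t, ContinuousWithinAt g (Set.Ici t) t := by
    intro t
    refine ContinuousWithinAt.comp (t := Set.Ici (Set.projIcc 0 T hT t)) (hf _).1
      continuous_projIcc.continuousWithinAt ?_
    intro s hs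
    exact Set.monotone_projIcc hT hs
  refine measurable_of_tendsto_metrizable
    (f := fun (n : ℕ) t => g ((⌊((n : ℝ) + 1) * t⌋ + 1) / ((n : ℝ) + 1))) ?_ ?_
  · intro n
    exact (measurable_from_top (f := fun k : ℤ => g ((k + 1) / ((n : ℝ) + 1)))).comp
      (Int.measurable_floor.comp (measurable_const_mul _))
  · rw [tendsto_pi_nhds]
    intro t
    refine (hr t).tendsto.comp (tendsto_nhdsWithin_iff.2 ⟨?_, ?_⟩)
    · refine tendsto_of_tendsto_of_tendsto_of_le_of_le tendsto_const_nhds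
        (h := fun n : ℕ => t + 1 / ((n : ℝ) + 1)) ?_ ?_ ?_
      · simpa using tendsto_const_nhds.add (tendsto_one_div_add_atTop_nhds_zero_nat (𝕜 := ℝ))
      · intro n
        have hn : (0 : ℝ) < n + 1 := by positivity
        rw [le_div_iff₀ hn]
        linarith [Int.lt_floor_add_one (((n : ℝ) + 1) * t)]
      · intro n
        have hn : (0 : ℝ) < n + 1 := by positivity
        show _ ≤ t + 1 / ((n : ℝ) + 1)
        rw [div_le_iff₀ hn]
        have e : (t + 1 / ((n : ℝ) + 1)) * ((n : ℝ) + 1) = ((n : ℝ) + 1) * t + 1 := by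
          field_simp
        rw [e]
        linarith [Int.floor_le (((n : ℝ) + 1) * t)]
    · refine Eventually.of_forall fun n => ?_
      have hn : (0 : ℝ) < n + 1 := by positivity
      rw [Set.mem_Ici, le_div_iff₀ hn]
      linarith [Int.lt_floor_add_one (((n : ℝ) + 1) * t)]

theorem IsCadlag.intervalIntegrable_extend {T : ℝ} (hT : 0 ≤ T) {f : Set.Icc (0 : ℝ) T → ℝ}
    (hf : IsCadlag f) (a b : ℝ) :
    IntervalIntegrable (fun t => f (Set.projIcc 0 T hT t)) volume a b := by
  obtain ⟨C, hC⟩ := hf.exists_bound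
  refine (intervalIntegrable_const (c := C)).mono_fun
    (hf.measurable_extend hT).aestronglyMeasurable (Eventually.of_forall fun t => ?_)
  rw [Real.norm_eq_abs]
  exact (hC _).trans (le_abs_self _)

/-- The identity time change is admissible. As the limit paths are continuous in time, every
approximation below is uniform and this is the only time change used. -/
theorem SkorokhodSpace.edist_le_iSup {T : ℝ} {E : Type*} [PseudoEMetricSpace E]
    (f g : SkorokhodSpace T E) : edist f g ≤ ⨆ t, edist (f.toFun t) (g.toFun t) := by
  rw [SkorokhodSpace.edist_def]
  exact iInf_le_of_le (OrderIso.refl _) (by simp)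

/-! ### The linear flow -/

/-- The solution `t ↦ y + exp(-tA) (g - y)` of `h' = A (y - h)`, `h 0 = g`. -/
noncomputable def linearFlow {V : Type*} [NormedAddCommGroup V] [NormedSpace ℝ V]
    (A : V →L[ℝ] V) (y g : V) (t : ℝ) : V := y + NormedSpace.exp (t • -A) (g - y)

theorem linearFlow_zero {V : Type*} [NormedAddCommGroup V] [NormedSpace ℝ V]
    (A : V →L[ℝ] V) (y g : V) : linearFlow A y g 0 = g := by
  simp [linearFlow]

theorem linearFlow_sub_linearFlow {V : Type*} [NormedAddCommGroup V] [NormedSpace ℝ V]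
    (A : V →L[ℝ] V) (y g g' : V) (t : ℝ) :
    linearFlow A y g t - linearFlow A y g' t = NormedSpace.exp (t • -A) (g - g') := by
  rw [linearFlow, linearFlow, add_sub_add_left_eq_sub, ← map_sub, sub_sub_sub_cancel_right]

section Flow

variable {V : Type*} [NormedAddCommGroup V] [NormedSpace ℝ V] [CompleteSpace V]
  (A : V →L[ℝ] V) (y g : V)

theorem hasDerivAt_linearFlow (t : ℝ) :
    HasDerivAt (linearFlow A y g) (A (y - linearFlow A y g t)) t := by
  have h := (hasDerivAt_exp_smul_const' (𝕂 := ℝ) (-A) t).clm_apply (hasDerivAt_const t (g - y))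
  have e : A (y - linearFlow A y g t) = (-A * NormedSpace.exp (t • -A)) (g - y)
      + (NormedSpace.exp (t • -A)) 0 := by
    rw [linearFlow, sub_add_cancel_left, map_neg, map_zero, add_zero]
    rfl
  rw [e]
  exact h.const_add y

theorem continuous_linearFlow : Continuous (linearFlow A y g) :=
  continuous_iff_continuousAt.2 fun t => (hasDerivAt_linearFlow A y g t).continuousAt

theorem exists_norm_exp_smul_neg_le (S : ℝ) :
    ∃ C : ℝ, 0 ≤ C ∧ ∀ t ∈ Set.Icc 0 S, ‖NormedSpace.exp (t • -A)‖ ≤ C := by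
  have hc : Continuous fun t : ℝ => NormedSpace.exp (t • -A) :=
    continuous_iff_continuousAt.2 fun t =>
      (hasDerivAt_exp_smul_const' (𝕂 := ℝ) (-A) t).continuousAt
  obtain ⟨C, hC⟩ := (isCompact_Icc (a := (0 : ℝ)) (b := S)).exists_bound_of_continuousOn
    hc.continuousOn
  exact ⟨max C 0, le_max_right _ _, fun t ht => (hC t ht).trans (le_max_left _ _)⟩

/-- Lipschitz and Euler errors of the flow, with one constant for all starting points in a ball,
because the starting point will be the random initial output. The Euler error is the mean value
inequality for the flow minus its tangent at s. -/
theorem exists_linearFlow_bounds (S R : ℝ) :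
    ∃ C : ℝ, 0 ≤ C ∧ ∀ g : V, ‖g‖ ≤ R → ∀ s ∈ Set.Icc 0 S, ∀ t ∈ Set.Icc 0 S, s ≤ t →
      ‖linearFlow A y g t - linearFlow A y g s‖ ≤ C * (t - s) ∧
      ‖linearFlow A y g t - linearFlow A y g s - (t - s) • A (y - linearFlow A y g s)‖ ≤
        C * (t - s) ^ 2 := by
  obtain ⟨C, hC0, hC⟩ := exists_norm_exp_smul_neg_le A S
  set D : ℝ := ‖A‖ * (C * (|R| + ‖y‖)) with hD
  have hD0 : 0 ≤ D := by positivity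
  have hbd : ∀ g : V, ‖g‖ ≤ R → ∀ t ∈ Set.Icc 0 S, ‖A (y - linearFlow A y g t)‖ ≤ D := by
    intro g hg t ht
    refine (A.le_opNorm _).trans (mul_le_mul_of_nonneg_left ?_ (norm_nonneg _))
    rw [linearFlow, sub_add_cancel_left, norm_neg]
    refine ((NormedSpace.exp (t • -A)).le_opNorm _).trans ?_
    refine mul_le_mul (hC t ht) ?_ (norm_nonneg _) hC0
    exact (norm_sub_le _ _).trans (add_le_add (hg.trans (le_abs_self _)) le_rfl)
  have h1 : ∀ g : V, ‖g‖ ≤ R → ∀ s ∈ Set.Icc 0 S, ∀ t ∈ Set.Icc 0 S, s ≤ t →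
      ‖linearFlow A y g t - linearFlow A y g s‖ ≤ D * (t - s) := by
    intro g hg s hs t ht hst
    have := Convex.norm_image_sub_le_of_norm_hasDerivWithin_le (𝕜 := ℝ) (s := Set.Icc 0 S)
      (fun x _ => (hasDerivAt_linearFlow A y g x).hasDerivWithinAt)
      (hbd g hg) (convex_Icc 0 S) hs ht
    rwa [Real.norm_eq_abs, abs_of_nonneg (sub_nonneg.2 hst)] at this
  refine ⟨max D (‖A‖ * D), le_max_of_le_left hD0, fun g hg s hs t ht hst => ⟨?_, ?_⟩⟩
  · exact (h1 g hg s hs t ht hst).trans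
      (mul_le_mul_of_nonneg_right (le_max_left _ _) (sub_nonneg.2 hst))
  · have key := Convex.norm_image_sub_le_of_norm_hasDerivWithin_le (𝕜 := ℝ) (s := Set.Icc s t)
      (f := fun x => linearFlow A y g x - x • A (y - linearFlow A y g s))
      (f' := fun x => A (y - linearFlow A y g x) - A (y - linearFlow A y g s))
      (C := ‖A‖ * (D * (t - s)))
      (fun x _ => by
        have := (hasDerivAt_linearFlow A y g x).fun_sub
          ((hasDerivAt_id x).smul_const (A (y - linearFlow A y g s)))
        simpa using this.hasDerivWithinAt)
      (fun x hx => by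
        rw [← map_sub, sub_sub_sub_cancel_left, ← norm_neg, ← map_neg, neg_sub]
        refine (A.le_opNorm _).trans (mul_le_mul_of_nonneg_left ?_ (norm_nonneg _))
        refine (h1 g hg s hs x ⟨hs.1.trans hx.1, hx.2.trans ht.2⟩ hx.1).trans ?_
        exact mul_le_mul_of_nonneg_left (by linarith [hx.2]) hD0)
      (convex_Icc s t) (Set.left_mem_Icc.2 hst) (Set.right_mem_Icc.2 hst)
    rw [Real.norm_eq_abs, abs_of_nonneg (sub_nonneg.2 hst)] at key
    calc _ = ‖(linearFlow A y g t - t • A (y - linearFlow A y g s)) -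
          (linearFlow A y g s - s • A (y - linearFlow A y g s))‖ := by congr 1; module
      _ ≤ ‖A‖ * (D * (t - s)) * (t - s) := key
      _ = (‖A‖ * D) * (t - s) ^ 2 := by ring
      _ ≤ _ := mul_le_mul_of_nonneg_right (le_max_right _ _) (sq_nonneg _)

end Flow

/-! ### Convergence in distribution -/

/-- Slutsky's lemma in a pseudo-emetric space, without any separability assumption. -/
theorem tendstoInDistribution_of_tendsto_measure_edist {E Ω Ω' : Type*} [PseudoEMetricSpace E]
    [MeasurableSpace E] [BorelSpace E] [MeasurableSpace Ω] [MeasurableSpace Ω']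
    {P : Measure Ω} [IsProbabilityMeasure P] {P' : Measure Ω'} [IsProbabilityMeasure P']
    {X Y : ℕ → Ω → E} {Z : Ω' → E}
    (hX : TendstoInDistribution X atTop Z (fun _ => P) P') (hY : ∀ n, AEMeasurable (Y n) P)
    (hXY : ∀ ε : ℝ≥0∞, 0 < ε → Tendsto (fun n => P {ω | ε ≤ edist (X n ω) (Y n ω)}) atTop (𝓝 0)) :
    TendstoInDistribution Y atTop Z (fun _ => P) P' := by
  refine ⟨hY, hX.aemeasurable_limit, ?_⟩
  refine tendsto_of_forall_isClosed_limsup_le' fun F hF => ?_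
  -- If Y n lies in F, then either X n is at distance at least ε from Y n or X n lies in the closed
  -- ε-thickening of F. The first event is negligible, the portmanteau theorem for X handles the
  -- second, and ε → 0 recovers F.
  have key : ∀ ε : ℝ, 0 < ε → limsup (fun n => (P.map (Y n)) F) atTop ≤
      (P'.map Z) (Metric.cthickening ε F) := by
    intro ε hε
    have hcl : IsClosed (Metric.cthickening ε F) := Metric.isClosed_cthickening
    have h1 : ∀ n, (P.map (Y n)) F ≤ P {ω | ENNReal.ofReal ε ≤ edist (X n ω) (Y n ω)}
        + (P.map (X n)) (Metric.cthickening ε F) := by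
      intro n
      rw [Measure.map_apply_of_aemeasurable (hY n) hF.measurableSet,
        Measure.map_apply_of_aemeasurable (hX.forall_aemeasurable n) hcl.measurableSet]
      refine (measure_mono fun ω hω => ?_).trans (measure_union_le _ _)
      rcases le_or_gt (ENNReal.ofReal ε) (edist (X n ω) (Y n ω)) with h | h
      · exact Or.inl h
      · exact Or.inr (Metric.mem_cthickening_of_edist_le _ (Y n ω) ε F hω h.le)
    have h2 := ProbabilityMeasure.limsup_measure_closed_le_of_tendsto hX.tendsto hcl
    refine (limsup_le_limsup (Eventually.of_forall h1)).trans ?_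
    exact (ENNReal.limsup_add_of_left_tendsto_zero (hXY _ (ENNReal.ofReal_pos.2 hε)) _).trans_le h2
  have hlim : Tendsto (fun ε => (P'.map Z) (Metric.cthickening ε F)) (𝓝[>] 0)
      (𝓝 ((P'.map Z) F)) := by
    have := Measure.isProbabilityMeasure_map hX.aemeasurable_limit
    have h := tendsto_measure_cthickening_of_isClosed (μ := P'.map Z) (s := F)
      ⟨1, one_pos, measure_ne_top _ _⟩ hF
    exact h.mono_left nhdsWithin_le_nhds
  exact ge_of_tendsto hlim (by filter_upwards [self_mem_nhdsWithin] with ε hε using key ε hε)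

/-- Multivariate central limit theorem for centred i.i.d. random vectors. -/
theorem tendstoInDistribution_multivariate_clt {ι Ω Ω' : Type*} [Fintype ι] [DecidableEq ι]
    [MeasurableSpace Ω] [MeasurableSpace Ω'] {P : Measure Ω} [IsProbabilityMeasure P]
    {P' : Measure Ω'} [IsProbabilityMeasure P'] {X : ℕ → Ω → EuclideanSpace ℝ ι}
    {G : Ω' → EuclideanSpace ℝ ι} {S : Matrix ι ι ℝ} (hS : S.PosSemidef)
    (hX : MemLp (X 0) 2 P) (hmean : ∀ i, ∫ ω, X 0 ω i ∂P = 0)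
    (hcov : ∀ i j, ∫ ω, X 0 ω i * X 0 ω j ∂P = S i j)
    (hindep : iIndepFun X P) (hident : ∀ i, IdentDistrib (X i) (X 0) P P)
    (hG : AEMeasurable G P') (hGlaw : P'.map G = multivariateGaussian 0 S) :
    TendstoInDistribution (fun (n : ℕ) ω => (√(n : ℝ))⁻¹ • ∑ k ∈ Finset.range n, X k ω) atTop G
      (fun _ => P) P' := by
  have hXm : ∀ n, AEMeasurable (X n) P := fun n => (hident n).aemeasurable_fst
  have hmeas : ∀ n : ℕ, AEMeasurable (fun ω => (√(n : ℝ))⁻¹ • ∑ k ∈ Finset.range n, X k ω) P := by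
    intro n
    have := Finset.aemeasurable_fun_sum (Finset.range n) fun k _ => hXm k
    fun_prop
  refine ⟨hmeas, hG, ?_⟩
  refine ProbabilityMeasure.tendsto_iff_tendsto_charFun.2 fun t => ?_
  simp only [ProbabilityMeasure.coe_mk, hGlaw]
  have hcoord : ∀ i, MemLp (fun ω => X 0 ω i) 2 P := fun i =>
    (EuclideanSpace.proj (𝕜 := ℝ) i).comp_memLp' hX
  have hinner : ∀ ω, ⟪t, X 0 ω⟫ = ∑ i, t i * X 0 ω i := by
    intro ω
    simp [PiLp.inner_apply, mul_comm]
  -- Cramér–Wold: the characteristic function of the normalised vector sum at t is that of the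
  -- normalised sum of the scalars ⟪t, X n⟫ at 1, to which the one-dimensional theorem applies.
  set Y : ℕ → Ω → ℝ := fun n ω => ⟪t, X n ω⟫ with hY
  have hYL : MemLp (Y 0) 2 P := (innerSL ℝ t).comp_memLp' hX
  have hYmean : P[Y 0] = 0 := by
    simp only [hY, hinner]
    rw [integral_finsetSum _ fun i _ => ((hcoord i).integrable (by norm_num)).const_mul _]
    simp [integral_const_mul, hmean]
  have hYvar : Var[Y 0; P] = t ⬝ᵥ S.mulVec t := by
    rw [variance_of_integral_eq_zero hYL.aemeasurable hYmean]
    have e : ∀ ω, Y 0 ω ^ 2 = ∑ i, ∑ j, t i * t j * (X 0 ω i * X 0 ω j) := by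
      intro ω
      simp only [hY, hinner, sq, Finset.sum_mul_sum]
      exact Finset.sum_congr rfl fun i _ => Finset.sum_congr rfl fun j _ => by ring
    have hint : ∀ i j, Integrable (fun ω => t i * t j * (X 0 ω i * X 0 ω j)) P := fun i j =>
      ((hcoord i).integrable_mul (hcoord j)).const_mul _
    simp only [e]
    rw [integral_finsetSum _ fun i _ => integrable_finsetSum _ fun j _ => hint i j]
    simp only [dotProduct, Matrix.mulVec, Finset.mul_sum]
    refine Finset.sum_congr rfl fun i _ => ?_
    rw [integral_finsetSum _ fun j _ => hint i j]
    refine Finset.sum_congr rfl fun j _ => ?_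
    rw [integral_const_mul, hcov]
    ring
  have hYindep : iIndepFun Y P := hindep.comp (fun _ x => ⟪t, x⟫) (fun _ => by fun_prop)
  have hYident : ∀ i, IdentDistrib (Y i) (Y 0) P P := fun i =>
    (hident i).comp (u := fun x => ⟪t, x⟫) (by fun_prop)
  have clt := tendstoInDistribution_inv_sqrt_mul_sum_sub (P' := gaussianReal 0 Var[Y 0; P].toNNReal)
    (Y := id) ⟨aemeasurable_id, Measure.map_id⟩ hYL hYindep hYident
  have h1 := ProbabilityMeasure.tendsto_iff_tendsto_charFun.1 clt.tendsto 1
  simp only [ProbabilityMeasure.coe_mk, Measure.map_id, charFun_gaussianReal] at h1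
  rw [charFun_multivariateGaussian hS]
  have hvar0 : 0 ≤ t ⬝ᵥ S.mulVec t := by rw [← hYvar]; exact variance_nonneg _ _
  convert h1 using 1
  · ext n
    rw [charFun_apply, charFun_apply, integral_map (hmeas n) (by fun_prop),
      integral_map (clt.forall_aemeasurable n) (by fun_prop)]
    congr 1
    ext ω
    congr 3
    rw [real_inner_comm, inner_smul_right, inner_sum, hYmean]
    simp [hY]
  · rw [hYvar, Real.coe_toNNReal _ hvar0]
    simp

/-! ### Empirical measures -/

theorem empiricalMeasure_apply {X : Type*} [MeasurableSpace X] {N : ℕ} [NeZero N] (θ : Fin N → X)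
    {s : Set X} (hs : MeasurableSet s) :
    (empiricalMeasure θ : Measure X) s = (N : ℝ≥0∞)⁻¹ * ∑ i, s.indicator 1 (θ i) := by
  simp [empiricalMeasure, Measure.dirac_apply' _ hs]

/-- Pair the atoms with equal index: an atom of the first measure in B has its partner in every
thickening of B whose radius exceeds the sup distance. -/
theorem edist_ofMeasure_empiricalMeasure_le {X : Type*} [PseudoMetricSpace X]
    [MeasurableSpace X] [BorelSpace X] {N : ℕ} [NeZero N] (θ θ' : Fin N → X) :
    edist (LevyProkhorov.ofMeasure (empiricalMeasure θ))
      (LevyProkhorov.ofMeasure (empiricalMeasure θ')) ≤ edist θ θ' := by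
  rw [LevyProkhorov.edist_probabilityMeasure_def]
  refine levyProkhorovEDist_le_of_forall_le _ _ _ fun ε B hε hεtop hB => ?_
  refine le_trans ?_ le_self_add
  show (empiricalMeasure θ : Measure X) B ≤ (empiricalMeasure θ' : Measure X) _
  rw [empiricalMeasure_apply _ hB,
    empiricalMeasure_apply _ Metric.isOpen_thickening.measurableSet]
  gcongr with i
  by_cases hi : θ i ∈ B
  · have : θ' i ∈ Metric.thickening ε.toReal B := by
      rw [Metric.mem_thickening_iff_exists_edist_lt]
      refine ⟨θ i, hi, ?_⟩
      rw [ENNReal.ofReal_toReal hεtop.ne, edist_comm]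
      exact (edist_le_pi_edist θ θ' i).trans_lt hε
    simp [hi, this]
  · simp [hi]

theorem continuous_ofMeasure_empiricalMeasure {X : Type*} [PseudoMetricSpace X]
    [MeasurableSpace X] [BorelSpace X] {N : ℕ} [NeZero N] :
    Continuous fun θ : Fin N → X => LevyProkhorov.ofMeasure (empiricalMeasure θ) :=
  (LipschitzWith.of_edist_le (edist_ofMeasure_empiricalMeasure_le)).continuous

/-- Strong law of large numbers for a real function of an i.i.d. sequence. -/
theorem ae_tendsto_average_comp {Ω X : Type*} [MeasurableSpace Ω] [MeasurableSpace X]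
    {P : Measure Ω} {μ : Measure X} {θ : ℕ → Ω → X} (hθ : ∀ i, Measurable (θ i))
    (hlaw : ∀ i, P.map (θ i) = μ) (hindep : iIndepFun θ P) {φ : X → ℝ} (hφ : Measurable φ)
    (hint : Integrable φ μ) :
    ∀ᵐ ω ∂P, Tendsto (fun n : ℕ => (n : ℝ)⁻¹ * ∑ i ∈ Finset.range n, φ (θ i ω)) atTop
      (𝓝 (∫ x, φ x ∂μ)) := by
  have h := strong_law_ae (μ := P) (fun i => φ ∘ θ i) ?_ ?_ ?_
  · have e : P[φ ∘ θ 0] = ∫ x, φ x ∂μ := by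
      rw [← hlaw 0, integral_map (hθ 0).aemeasurable hφ.aestronglyMeasurable]
      rfl
    rw [e] at h
    simpa using h
  · rw [← hlaw 0] at hint
    exact hint.comp_measurable (hθ 0)
  · intro i j hij
    exact (hindep.indepFun hij).comp hφ hφ
  · intro i
    exact IdentDistrib.comp ⟨(hθ i).aemeasurable, (hθ 0).aemeasurable, by rw [hlaw, hlaw]⟩ hφ

/-- The strong law holds simultaneously for the countably many finite unions of basic open sets.
Every open set is an increasing union of such sets, which gives the liminf inequality of the
portmanteau theorem. -/
theorem ae_tendsto_empiricalMeasure {Ω X : Type*} [MeasurableSpace Ω] [TopologicalSpace X]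
    [SecondCountableTopology X] [MeasurableSpace X] [BorelSpace X] {P : Measure Ω}
    {μ : ProbabilityMeasure X} {θ : ℕ → Ω → X} (hθ : ∀ i, Measurable (θ i))
    (hlaw : ∀ i, P.map (θ i) = (μ : Measure X)) (hindep : iIndepFun θ P) :
    ∀ᵐ ω ∂P, Tendsto (fun n : ℕ => empiricalMeasure fun i : Fin (n + 1) => θ i ω) atTop
      (𝓝 μ) := by
  set b := TopologicalSpace.countableBasis X
  have hbc : b.Countable := TopologicalSpace.countable_countableBasis X
  have hb := TopologicalSpace.isBasis_countableBasis X
  have hfin : {s : Set (Set X) | s.Finite ∧ s ⊆ b}.Countable :=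
    Set.countable_ofPred_finite_subset hbc
  have hopen : ∀ s ∈ {s : Set (Set X) | s.Finite ∧ s ⊆ b}, IsOpen (⋃₀ s) :=
    fun s hs => isOpen_sUnion fun t ht => hb.isOpen (hs.2 ht)
  have hae : ∀ᵐ ω ∂P, ∀ s ∈ {s : Set (Set X) | s.Finite ∧ s ⊆ b},
      Tendsto (fun n : ℕ => (n : ℝ)⁻¹ * ∑ i ∈ Finset.range n,
        (⋃₀ s).indicator (fun _ => (1 : ℝ)) (θ i ω)) atTop (𝓝 ((μ : Measure X).real (⋃₀ s))) := by
    refine (ae_ball_iff hfin).2 fun s hs => ?_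
    have hm := (hopen s hs).measurableSet
    have := ae_tendsto_average_comp hθ hlaw hindep (φ := (⋃₀ s).indicator (fun _ => (1 : ℝ)))
      (measurable_const.indicator hm) ((integrable_const _).indicator hm)
    simpa [integral_indicator hm] using this
  filter_upwards [hae] with ω hω
  refine tendsto_of_forall_isOpen_le_liminf_nat' fun U hU => ?_
  have hconv : ∀ s ∈ {s : Set (Set X) | s.Finite ∧ s ⊆ b},
      Tendsto (fun n : ℕ => (empiricalMeasure (fun i : Fin (n + 1) => θ i ω) : Measure X) (⋃₀ s))
        atTop (𝓝 ((μ : Measure X) (⋃₀ s))) := by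
    intro s hs
    have h1 := (hω s hs).comp (tendsto_add_atTop_nat 1)
    have h2 := ENNReal.tendsto_ofReal h1
    rw [ofReal_measureReal] at h2
    refine h2.congr fun n => ?_
    rw [empiricalMeasure_apply _ (hopen s hs).measurableSet, Function.comp_apply,
      ENNReal.ofReal_mul (by positivity), ENNReal.ofReal_inv_of_pos (by positivity),
      ENNReal.ofReal_natCast, ← Fin.sum_univ_eq_sum_range
        (fun i => (⋃₀ s).indicator (fun _ => (1 : ℝ)) (θ i ω)),
      ENNReal.ofReal_sum_of_nonneg fun i _ => Set.indicator_nonneg (fun _ _ => zero_le_one) _]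
    congr 1
    refine Finset.sum_congr rfl fun i _ => ?_
    by_cases hi : θ i ω ∈ ⋃₀ s <;> simp only [hi, Set.indicator_of_mem, Set.indicator_of_notMem,
      not_false_eq_true, ENNReal.ofReal_one, ENNReal.ofReal_zero, Pi.one_apply]
  obtain ⟨S, hSb, rfl⟩ := hb.open_eq_sUnion hU
  have hSc : S.Countable := hbc.mono hSb
  rcases S.eq_empty_or_nonempty with rfl | hne
  · simp
  obtain ⟨f, rfl⟩ := hSc.exists_eq_range hne
  have hunion : (⋃₀ Set.range f) = ⋃ n, ⋃₀ (f '' Set.Iic n) := by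
    ext x
    simp only [Set.mem_sUnion, Set.mem_range, exists_exists_eq_and, Set.mem_iUnion,
      Set.mem_image, Set.mem_Iic, exists_exists_and_eq_and]
    exact ⟨fun ⟨n, hn⟩ => ⟨n, n, le_rfl, hn⟩, fun ⟨_, k, _, hk⟩ => ⟨k, hk⟩⟩
  have hmono : Monotone fun n => ⋃₀ (f '' Set.Iic n) := fun m n hmn =>
    Set.sUnion_subset_sUnion (Set.image_mono (Set.Iic_subset_Iic.2 hmn))
  have hlim := tendsto_measure_iUnion_atTop (μ := (μ : Measure X)) hmono
  rw [← hunion] at hlim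
  refine le_of_tendsto hlim (Eventually.of_forall fun n => ?_)
  have hmem : f '' Set.Iic n ∈ {s : Set (Set X) | s.Finite ∧ s ⊆ b} :=
    ⟨(Set.finite_Iic n).image f, (Set.image_subset_range _ _).trans hSb⟩
  rw [Function.comp_apply, ← (hconv _ hmem).liminf_eq]
  refine liminf_le_liminf (Eventually.of_forall fun k => measure_mono ?_)
  exact Set.sUnion_subset_sUnion (Set.image_subset_range _ _)

/-! ### `C²_b` functions determine a measure -/

theorem isCb2_comp_clm {V : Type*} [NormedAddCommGroup V] [NormedSpace ℝ V] {φ : ℝ → ℝ}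
    (hφ : IsCb2 φ) (L : V →L[ℝ] ℝ) : IsCb2 (φ ∘ L) := by
  obtain ⟨h2, B, hB⟩ := hφ
  -- The k-th derivative acquires a factor ‖L‖^k, and (1 + ‖L‖)² dominates it for all k ≤ 2.
  refine ⟨h2.comp L.contDiff, B * (1 + ‖L‖) ^ 2, fun k hk v => ?_⟩
  have hB0 : 0 ≤ B := (norm_nonneg _).trans (hB 0 (by norm_num) 0)
  rw [L.iteratedFDeriv_comp_right h2 v (by exact_mod_cast hk)]
  refine (ContinuousMultilinearMap.norm_compContinuousLinearMap_le _ _).trans ?_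
  rw [Finset.prod_const, Finset.card_univ, Fintype.card_fin]
  refine mul_le_mul (hB k hk _) ?_ (by positivity) hB0
  calc ‖L‖ ^ k ≤ (1 + ‖L‖) ^ k := by gcongr; linarith
    _ ≤ (1 + ‖L‖) ^ 2 := pow_le_pow_right₀ (by linarith [norm_nonneg L]) hk

theorem isCb2_cos : IsCb2 Real.cos := by
  refine ⟨Real.contDiff_cos, 1, fun k hk v => ?_⟩
  rw [norm_iteratedFDeriv_eq_norm_iteratedDeriv]
  exact Real.abs_iteratedDeriv_cos_le_one k v

theorem isCb2_sin : IsCb2 Real.sin := by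
  refine ⟨Real.contDiff_sin, 1, fun k hk v => ?_⟩
  rw [norm_iteratedFDeriv_eq_norm_iteratedDeriv]
  exact Real.abs_iteratedDeriv_sin_le_one k v

/-- The real and imaginary parts of the characteristic functional are integrals of cos ∘ L and sin ∘
L, which are of class C²_b. -/
theorem measure_ext_of_forall_isCb2 {V : Type*} [NormedAddCommGroup V] [NormedSpace ℝ V]
    [MeasurableSpace V] [BorelSpace V] [SecondCountableTopology V] [CompleteSpace V]
    {μ ν : Measure V} [IsProbabilityMeasure μ] [IsProbabilityMeasure ν]
    (h : ∀ f : V → ℝ, IsCb2 f → ∫ v, f v ∂μ = ∫ v, f v ∂ν) : μ = ν := by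
  refine Measure.ext_of_charFunDual ?_
  ext L
  have key : ∀ (ρ : Measure V) [IsProbabilityMeasure ρ], charFunDual ρ L =
      ((∫ v, Real.cos (L v) ∂ρ : ℝ) : ℂ) + ((∫ v, Real.sin (L v) ∂ρ : ℝ) : ℂ) * Complex.I := by
    intro ρ _
    have hcos : Integrable (fun v => Real.cos (L v)) ρ :=
      Integrable.of_bound (by fun_prop) 1 (Eventually.of_forall fun v => Real.abs_cos_le_one _)
    have hsin : Integrable (fun v => Real.sin (L v)) ρ :=
      Integrable.of_bound (by fun_prop) 1 (Eventually.of_forall fun v => Real.abs_sin_le_one _)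
    rw [charFunDual_apply, ← integral_complex_ofReal, ← integral_complex_ofReal,
      ← integral_mul_const, ← integral_add hcos.ofReal (hsin.ofReal.mul_const _)]
    congr 1
    ext v
    rw [Complex.exp_mul_I, Complex.ofReal_cos, Complex.ofReal_sin]
  rw [key, key]
  have hc := h _ (isCb2_comp_clm isCb2_cos L)
  have hs := h _ (isCb2_comp_clm isCb2_sin L)
  simp only [Function.comp_apply] at hc hs
  rw [hc, hs]

/-! ### Deterministic estimates for stochastic gradient descent -/

/-- The contribution of the hidden unit `p = (c, w)` to the tangent kernel. -/
noncomputable def tangentKernel {d : ℕ} (σ : ℝ → ℝ) (x x' : EuclideanSpace ℝ (Fin d))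
    (p : ParamSpace d) : ℝ :=
  σ ⟪p.2, x⟫ * σ ⟪p.2, x'⟫ + p.1 ^ 2 * deriv σ ⟪p.2, x'⟫ * deriv σ ⟪p.2, x⟫ * ⟪x, x'⟫

/-! ### One gradient step for a single hidden unit -/

section Unit

variable {d : ℕ} {σ : ℝ → ℝ} {B K X : ℝ} {x x' : EuclideanSpace ℝ (Fin d)}

theorem abs_inner_le_sq (hx : ‖x‖ ≤ X) (hx' : ‖x'‖ ≤ X) : |⟪x, x'⟫| ≤ X ^ 2 :=
  (abs_real_inner_le_norm x x').trans (by
    rw [sq]; exact mul_le_mul hx hx' (norm_nonneg _) ((norm_nonneg _).trans hx))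

/-- Here x' is the sample and s stands for α N^{-3/2} (y - g(x')), common to all units. The step
shifts ⟪w, x⟫ by δ = O(s), so both factors of c σ(⟪w, x⟫) change by O(s). -/
theorem abs_unit_step_le (hB0 : 0 ≤ B) (hb : ∀ z, |σ z| ≤ B) (hb1 : ∀ z, |deriv σ z| ≤ B)
    (hL : ∀ y z, |σ y - σ z| ≤ B * |y - z|) (hx : ‖x‖ ≤ X) (hx' : ‖x'‖ ≤ X)
    {p : ParamSpace d} (hp : |p.1| ≤ K) (s : ℝ) :
    |(p.1 + s * σ ⟪p.2, x'⟫) * σ ⟪p.2 + (s * p.1 * deriv σ ⟪p.2, x'⟫) • x', x⟫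
      - p.1 * σ ⟪p.2, x⟫| ≤ |s| * (B ^ 2 + K ^ 2 * B ^ 2 * X ^ 2) := by
  have hK : 0 ≤ K := (abs_nonneg _).trans hp
  have hin : |⟪x', x⟫| ≤ X ^ 2 := abs_inner_le_sq hx' hx
  rw [inner_add_left, real_inner_smul_left]
  set z := ⟪p.2, x⟫
  set δ := s * p.1 * deriv σ ⟪p.2, x'⟫ * ⟪x', x⟫ with hδ
  have hδle : |δ| ≤ |s| * K * B * X ^ 2 := by
    rw [hδ, abs_mul, abs_mul, abs_mul]
    have := hb1 ⟪p.2, x'⟫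
    gcongr
  have h1 : |s * σ ⟪p.2, x'⟫ * σ (z + δ)| ≤ |s| * B * B := by
    rw [abs_mul, abs_mul]
    have := hb ⟪p.2, x'⟫
    have := hb (z + δ)
    gcongr
  have h2 : |p.1 * (σ (z + δ) - σ z)| ≤ K * (B * (|s| * K * B * X ^ 2)) := by
    rw [abs_mul]
    have h3 : |σ (z + δ) - σ z| ≤ B * (|s| * K * B * X ^ 2) := by
      refine (hL _ _).trans ?_
      rw [add_sub_cancel_left]
      gcongr
    gcongr
  calc _ = |s * σ ⟪p.2, x'⟫ * σ (z + δ) + p.1 * (σ (z + δ) - σ z)| := by congr 1; ring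
    _ ≤ |s| * B * B + K * (B * (|s| * K * B * X ^ 2)) :=
        (abs_add_le _ _).trans (add_le_add h1 h2)
    _ = _ := by ring

/-- The part linear in s is exactly s times the tangent kernel. What is left is the product of the
two increments and c times the Taylor remainder of σ, both of order s². -/
theorem abs_unit_step_sub_le (hB0 : 0 ≤ B) (hd : Differentiable ℝ σ) (hb : ∀ z, |σ z| ≤ B)
    (hb1 : ∀ z, |deriv σ z| ≤ B) (hL : ∀ y z, |σ y - σ z| ≤ B * |y - z|)
    (hL1 : ∀ y z, |deriv σ y - deriv σ z| ≤ B * |y - z|) (hx : ‖x‖ ≤ X) (hx' : ‖x'‖ ≤ X)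
    {p : ParamSpace d} (hp : |p.1| ≤ K) (s : ℝ) :
    |(p.1 + s * σ ⟪p.2, x'⟫) * σ ⟪p.2 + (s * p.1 * deriv σ ⟪p.2, x'⟫) • x', x⟫
      - p.1 * σ ⟪p.2, x⟫ - s * tangentKernel σ x x' p| ≤
      s ^ 2 * (B ^ 3 * K * X ^ 2 + K ^ 3 * B ^ 3 * X ^ 4) := by
  have hK : 0 ≤ K := (abs_nonneg _).trans hp
  have hin : |⟪x', x⟫| ≤ X ^ 2 := abs_inner_le_sq hx' hx
  rw [inner_add_left, real_inner_smul_left, tangentKernel, real_inner_comm x' x]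
  set z := ⟪p.2, x⟫
  set δ := s * p.1 * deriv σ ⟪p.2, x'⟫ * ⟪x', x⟫ with hδ
  have hδle : |δ| ≤ |s| * K * B * X ^ 2 := by
    rw [hδ, abs_mul, abs_mul, abs_mul]
    have := hb1 ⟪p.2, x'⟫
    gcongr
  have h1 : |s * σ ⟪p.2, x'⟫ * (σ (z + δ) - σ z)| ≤ |s| * B * (B * (|s| * K * B * X ^ 2)) := by
    rw [abs_mul, abs_mul]
    have := hb ⟪p.2, x'⟫
    have h3 : |σ (z + δ) - σ z| ≤ B * (|s| * K * B * X ^ 2) := by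
      refine (hL _ _).trans ?_
      rw [add_sub_cancel_left]
      gcongr
    gcongr
  have h2 : |p.1 * (σ (z + δ) - σ z - deriv σ z * δ)| ≤ K * (B * (|s| * K * B * X ^ 2) ^ 2) := by
    rw [abs_mul]
    have h3 := abs_sub_sub_deriv_mul_le hd hL1 hB0 z (z + δ)
    rw [add_sub_cancel_left] at h3
    have h4 : B * |δ| ^ 2 ≤ B * (|s| * K * B * X ^ 2) ^ 2 := by gcongr
    have h5 := h3.trans h4
    gcongr
  calc _ = |s * σ ⟪p.2, x'⟫ * (σ (z + δ) - σ z) + p.1 * (σ (z + δ) - σ z - deriv σ z * δ)| := by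
        congr 1; rw [hδ]; ring
    _ ≤ |s| * B * (B * (|s| * K * B * X ^ 2)) + K * (B * (|s| * K * B * X ^ 2) ^ 2) :=
        (abs_add_le _ _).trans (add_le_add h1 h2)
    _ = |s| ^ 2 * (B ^ 3 * K * X ^ 2 + K ^ 3 * B ^ 3 * X ^ 4) := by ring
    _ = _ := by rw [sq_abs]

theorem abs_mul_sub_mul_le {a a' b b' A D ε η : ℝ} (ha : |a| ≤ A) (hb' : |b'| ≤ D)
    (h1 : |a - a'| ≤ ε) (h2 : |b - b'| ≤ η) : |a * b - a' * b'| ≤ A * η + ε * D := by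
  have e : a * b - a' * b' = a * (b - b') + (a - a') * b' := by ring
  rw [e]
  refine (abs_add_le _ _).trans (add_le_add ?_ ?_)
  · rw [abs_mul]
    exact mul_le_mul ha h2 (abs_nonneg _) ((abs_nonneg _).trans ha)
  · rw [abs_mul]
    exact mul_le_mul h1 hb' (abs_nonneg _) ((abs_nonneg _).trans h1)

/-- Repeated product rule; the bound K on the coefficients is needed because c² is only locally
Lipschitz. -/
theorem abs_tangentKernel_sub_le (hb : ∀ z, |σ z| ≤ B) (hb1 : ∀ z, |deriv σ z| ≤ B)
    (hL : ∀ y z, |σ y - σ z| ≤ B * |y - z|)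
    (hL1 : ∀ y z, |deriv σ y - deriv σ z| ≤ B * |y - z|) (hB0 : 0 ≤ B)
    (hx : ‖x‖ ≤ X) (hx' : ‖x'‖ ≤ X)
    {p q : ParamSpace d} (hp : |p.1| ≤ K) (hq : |q.1| ≤ K) :
    |tangentKernel σ x x' p - tangentKernel σ x x' q| ≤
      (2 * B ^ 2 * X + (2 * K * B ^ 2 + 2 * K ^ 2 * B ^ 2 * X) * X ^ 2) * ‖p - q‖ := by
  have hK : 0 ≤ K := (abs_nonneg _).trans hp
  set δ := ‖p - q‖
  have hc : |p.1 - q.1| ≤ δ := norm_fst_le (p - q)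
  have hw : ‖p.2 - q.2‖ ≤ δ := norm_snd_le (p - q)
  have hz : ∀ y : EuclideanSpace ℝ (Fin d), ‖y‖ ≤ X → |⟪p.2, y⟫ - ⟪q.2, y⟫| ≤ δ * X := by
    intro y hy
    rw [← inner_sub_left]
    exact (abs_real_inner_le_norm _ _).trans
      (mul_le_mul hw hy (norm_nonneg _) (norm_nonneg _))
  have hs : ∀ y : EuclideanSpace ℝ (Fin d), ‖y‖ ≤ X →
      |σ ⟪p.2, y⟫ - σ ⟪q.2, y⟫| ≤ B * (δ * X) := fun y hy =>
    (hL _ _).trans (mul_le_mul_of_nonneg_left (hz y hy) hB0)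
  have hs1 : ∀ y : EuclideanSpace ℝ (Fin d), ‖y‖ ≤ X →
      |deriv σ ⟪p.2, y⟫ - deriv σ ⟪q.2, y⟫| ≤ B * (δ * X) := fun y hy =>
    (hL1 _ _).trans (mul_le_mul_of_nonneg_left (hz y hy) hB0)
  have hsq : |p.1 ^ 2 - q.1 ^ 2| ≤ 2 * K * δ := by
    have := abs_mul_sub_mul_le hp hq hc hc
    rw [← sq, ← sq] at this
    linarith
  have hp2 : |p.1 ^ 2| ≤ K ^ 2 := by rw [abs_pow]; gcongr
  have t1 := abs_mul_sub_mul_le (hb ⟪p.2, x⟫) (hb ⟪q.2, x'⟫) (hs x hx) (hs x' hx')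
  have t2 := abs_mul_sub_mul_le hp2 (hb1 ⟪q.2, x'⟫) hsq (hs1 x' hx')
  have hp3 : |p.1 ^ 2 * deriv σ ⟪p.2, x'⟫| ≤ K ^ 2 * B := by
    rw [abs_mul]
    exact mul_le_mul hp2 (hb1 _) (abs_nonneg _) (sq_nonneg _)
  have t3 := abs_mul_sub_mul_le hp3 (hb1 ⟪q.2, x⟫) t2 (hs1 x hx)
  have t4 : |(p.1 ^ 2 * deriv σ ⟪p.2, x'⟫ * deriv σ ⟪p.2, x⟫
      - q.1 ^ 2 * deriv σ ⟪q.2, x'⟫ * deriv σ ⟪q.2, x⟫) * ⟪x, x'⟫| ≤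
      (K ^ 2 * B * (B * (δ * X)) + (K ^ 2 * (B * (δ * X)) + 2 * K * δ * B) * B) * X ^ 2 := by
    rw [abs_mul]
    exact mul_le_mul t3 (abs_inner_le_sq hx hx') (abs_nonneg _) ((abs_nonneg _).trans t3)
  rw [tangentKernel, tangentKernel, add_sub_add_comm, ← sub_mul]
  refine (abs_add_le _ _).trans ((add_le_add t1 t4).trans (le_of_eq ?_))
  ring

end Unit

/-! ### One gradient step for the whole network -/

section Network

variable {d N : ℕ} {σ : ℝ → ℝ} {B K X v α : ℝ} {x : EuclideanSpace ℝ (Fin d)}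

theorem sgd_step_scalar_le {a : ℝ} (hv : |a| ≤ v) :
    |α / N / √(N : ℝ) * a| ≤ |α| * v / (N * √(N : ℝ)) := by
  rw [abs_mul, abs_div, abs_div, Nat.abs_cast, abs_of_nonneg (Real.sqrt_nonneg _), div_div,
    div_mul_eq_mul_div]
  gcongr

theorem norm_sgdStep_sub_le (hB0 : 0 ≤ B) (hb : ∀ z, |σ z| ≤ B) (hb1 : ∀ z, |deriv σ z| ≤ B)
    {q : EuclideanSpace ℝ (Fin d) × ℝ} (hq : ‖q.1‖ ≤ X) {θ : Fin N → ParamSpace d}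
    (hθ : ∀ i, |(θ i).1| ≤ K) (hv : |q.2 - netOutput σ θ q.1| ≤ v) (i : Fin N) :
    ‖sgdStep σ (α / N) θ q i - θ i‖ ≤ |α| * v * (B + K * B * X) / (N * √(N : ℝ)) := by
  have hs := sgd_step_scalar_le (N := N) (α := α) hv
  have hK : 0 ≤ K := (abs_nonneg _).trans (hθ i)
  have hX : 0 ≤ X := (norm_nonneg _).trans hq
  set s := α / N / √(N : ℝ) * (q.2 - netOutput σ θ q.1) with hsdef
  have e : sgdStep σ (α / N) θ q i - θ i =
      (s * σ ⟪(θ i).2, q.1⟫, (s * (θ i).1 * deriv σ ⟪(θ i).2, q.1⟫) • q.1) :=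
    Prod.ext (add_sub_cancel_left _ _) (add_sub_cancel_left _ _)
  have h1 : |s| * (B + K * B * X) ≤ |α| * v * (B + K * B * X) / (N * √(N : ℝ)) := by
    rw [mul_div_right_comm]
    gcongr
  refine le_trans ?_ h1
  rw [e, Prod.norm_def, Real.norm_eq_abs, norm_smul, Real.norm_eq_abs]
  refine max_le ?_ ?_
  · rw [abs_mul]
    refine mul_le_mul_of_nonneg_left ((hb _).trans ?_) (abs_nonneg _)
    linarith [mul_nonneg (mul_nonneg hK hB0) hX]
  · rw [abs_mul, abs_mul, mul_assoc, mul_assoc]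
    refine mul_le_mul_of_nonneg_left ?_ (abs_nonneg _)
    have h2 : |(θ i).1| * (|deriv σ ⟪(θ i).2, q.1⟫| * ‖q.1‖) ≤ K * (B * X) :=
      mul_le_mul (hθ i) (mul_le_mul (hb1 _) hq (norm_nonneg _) hB0) (by positivity) hK
    linarith

variable [NeZero N]

variable (N) in
theorem natCast_pos_of_neZero : (0 : ℝ) < N := Nat.cast_pos.2 (NeZero.pos N)

/-- N units each contribute O(N^{-3/2}) under the prefactor N^{-1/2}, hence 1/N. The residual bound
v enters linearly, so that iterating gives geometric growth with ratio 1 + O(1/N). -/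
theorem abs_netOutput_sgdStep_sub_le (hB0 : 0 ≤ B) (hb : ∀ z, |σ z| ≤ B)
    (hb1 : ∀ z, |deriv σ z| ≤ B) (hL : ∀ y z, |σ y - σ z| ≤ B * |y - z|) (hx : ‖x‖ ≤ X)
    {q : EuclideanSpace ℝ (Fin d) × ℝ} (hq : ‖q.1‖ ≤ X) {θ : Fin N → ParamSpace d}
    (hθ : ∀ i, |(θ i).1| ≤ K) (hv : |q.2 - netOutput σ θ q.1| ≤ v) :
    |netOutput σ (sgdStep σ (α / N) θ q) x - netOutput σ θ x| ≤
      |α| * (B ^ 2 + K ^ 2 * B ^ 2 * X ^ 2) / N * v := by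
  have hN : (0 : ℝ) < N := natCast_pos_of_neZero N
  have hsN : 0 < √(N : ℝ) := Real.sqrt_pos.2 hN
  have hss : √(N : ℝ) * √(N : ℝ) = N := Real.mul_self_sqrt hN.le
  have hs := sgd_step_scalar_le (N := N) (α := α) hv
  set s := α / N / √(N : ℝ) * (q.2 - netOutput σ θ q.1) with hsdef
  have hb0 : 0 ≤ B ^ 2 + K ^ 2 * B ^ 2 * X ^ 2 := by positivity
  rw [netOutput, netOutput, ← mul_sub, ← Finset.sum_sub_distrib, abs_mul,
    abs_of_pos (by positivity)]
  calc 1 / √(N : ℝ) * |∑ i, (((sgdStep σ (α / N) θ q) i).1 *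
          σ ⟪((sgdStep σ (α / N) θ q) i).2, x⟫ - (θ i).1 * σ ⟪(θ i).2, x⟫)|
      ≤ 1 / √(N : ℝ) * ∑ i : Fin N, |s| * (B ^ 2 + K ^ 2 * B ^ 2 * X ^ 2) := by
        gcongr
        refine (Finset.abs_sum_le_sum_abs _ _).trans (Finset.sum_le_sum fun i _ => ?_)
        exact abs_unit_step_le hB0 hb hb1 hL hx hq (hθ i) s
    _ = √(N : ℝ) * |s| * (B ^ 2 + K ^ 2 * B ^ 2 * X ^ 2) := by
        rw [Finset.sum_const, Finset.card_univ, Fintype.card_fin, nsmul_eq_mul]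
        nth_rewrite 2 [← hss]
        field_simp
    _ ≤ √(N : ℝ) * (|α| * v / (N * √(N : ℝ))) * (B ^ 2 + K ^ 2 * B ^ 2 * X ^ 2) := by
        gcongr
    _ = _ := by field_simp

/-- Summing N second-order errors of size N^{-3} under the prefactor N^{-1/2} gives N^{-5/2}. The
weaker rate N^{-3/2} is stated because freezing the kernel at its initial value costs that much
anyway. -/
theorem abs_netOutput_sgdStep_sub_sub_le (hB0 : 0 ≤ B) (hd : Differentiable ℝ σ)
    (hb : ∀ z, |σ z| ≤ B) (hb1 : ∀ z, |deriv σ z| ≤ B)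
    (hL : ∀ y z, |σ y - σ z| ≤ B * |y - z|)
    (hL1 : ∀ y z, |deriv σ y - deriv σ z| ≤ B * |y - z|) (hx : ‖x‖ ≤ X)
    {q : EuclideanSpace ℝ (Fin d) × ℝ} (hq : ‖q.1‖ ≤ X) {θ : Fin N → ParamSpace d}
    (hK : 0 ≤ K) (hθ : ∀ i, |(θ i).1| ≤ K) (hv : |q.2 - netOutput σ θ q.1| ≤ v) :
    |netOutput σ (sgdStep σ (α / N) θ q) x - netOutput σ θ x
      - α / N * (q.2 - netOutput σ θ q.1) * (1 / N * ∑ i, tangentKernel σ x q.1 (θ i))| ≤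
      α ^ 2 * v ^ 2 * (B ^ 3 * K * X ^ 2 + K ^ 3 * B ^ 3 * X ^ 4) / (N * √(N : ℝ)) := by
  have hN : (0 : ℝ) < N := natCast_pos_of_neZero N
  have hN1 : (1 : ℝ) ≤ N := by exact_mod_cast NeZero.one_le
  have hsN : 0 < √(N : ℝ) := Real.sqrt_pos.2 hN
  have hss : √(N : ℝ) * √(N : ℝ) = N := Real.mul_self_sqrt hN.le
  have hs := sgd_step_scalar_le (N := N) (α := α) hv
  set s := α / N / √(N : ℝ) * (q.2 - netOutput σ θ q.1) with hsdef
  have hX : 0 ≤ X := (norm_nonneg _).trans hx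
  have hb0 : 0 ≤ B ^ 3 * K * X ^ 2 + K ^ 3 * B ^ 3 * X ^ 4 := by positivity
  have e1 : α / N * (q.2 - netOutput σ θ q.1) * (1 / N * ∑ i, tangentKernel σ x q.1 (θ i)) =
      1 / √(N : ℝ) * ∑ i, s * tangentKernel σ x q.1 (θ i) := by
    rw [← Finset.mul_sum, hsdef]
    nth_rewrite 2 [← hss]
    field_simp
  rw [e1, netOutput, netOutput, ← mul_sub, ← mul_sub, ← Finset.sum_sub_distrib, ← Finset.sum_sub_distrib, abs_mul,
    abs_of_pos (by positivity)]
  calc 1 / √(N : ℝ) * |∑ i, (((sgdStep σ (α / N) θ q) i).1 *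
          σ ⟪((sgdStep σ (α / N) θ q) i).2, x⟫ - (θ i).1 * σ ⟪(θ i).2, x⟫
          - s * tangentKernel σ x q.1 (θ i))|
      ≤ 1 / √(N : ℝ) * ∑ i : Fin N, s ^ 2 * (B ^ 3 * K * X ^ 2 + K ^ 3 * B ^ 3 * X ^ 4) := by
        gcongr
        refine (Finset.abs_sum_le_sum_abs _ _).trans (Finset.sum_le_sum fun i _ => ?_)
        exact abs_unit_step_sub_le hB0 hd hb hb1 hL hL1 hx hq (hθ i) s
    _ = √(N : ℝ) * |s| ^ 2 * (B ^ 3 * K * X ^ 2 + K ^ 3 * B ^ 3 * X ^ 4) := by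
        rw [Finset.sum_const, Finset.card_univ, Fintype.card_fin, nsmul_eq_mul, sq_abs]
        nth_rewrite 2 [← hss]
        field_simp
    _ ≤ √(N : ℝ) * (|α| * v / (N * √(N : ℝ))) ^ 2 *
          (B ^ 3 * K * X ^ 2 + K ^ 3 * B ^ 3 * X ^ 4) := by
        gcongr
    _ = (α ^ 2 * v ^ 2 * (B ^ 3 * K * X ^ 2 + K ^ 3 * B ^ 3 * X ^ 4) / (N * √(N : ℝ))) * (1 / N) := by
        rw [div_pow, mul_pow, sq_abs]
        field_simp
    _ ≤ _ := by
        refine mul_le_of_le_one_right (by positivity) ?_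
        rw [div_le_one hN]
        exact hN1

end Network

/-- Uniform bounds along the first `N T` steps of stochastic gradient descent. -/
theorem exists_sgd_bounds {d M : ℕ} {σ : ℝ → ℝ} (hσ : IsCb2 σ) (α K R : ℝ) {T : ℝ} (hT : 0 ≤ T)
    (xs : Fin M → EuclideanSpace ℝ (Fin d)) (ys : Fin M → ℝ) :
    ∃ C : ℝ, 0 ≤ C ∧ ∀ (N : ℕ) [NeZero N], C ≤ √(N : ℝ) → ∀ θ₀ : Fin N → ParamSpace d,
      (∀ i, |(θ₀ i).1| ≤ K) → (∀ m, |netOutput σ θ₀ (xs m)| ≤ R) →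
      ∀ ζ : ℕ → EuclideanSpace ℝ (Fin d) × ℝ, (∀ k, ∃ m, ζ k = (xs m, ys m)) →
      ∀ k : ℕ, (k : ℝ) ≤ N * T →
        (∀ i, ‖sgd σ α θ₀ ζ k i - θ₀ i‖ ≤ C / √(N : ℝ)) ∧
        (∀ m, |netOutput σ (sgd σ α θ₀ ζ k) (xs m)| ≤ C) ∧
        (∀ m, |netOutput σ (sgd σ α θ₀ ζ (k + 1)) (xs m) - netOutput σ (sgd σ α θ₀ ζ k) (xs m)| ≤
          C / N) ∧
        ∀ m, |netOutput σ (sgd σ α θ₀ ζ (k + 1)) (xs m) - netOutput σ (sgd σ α θ₀ ζ k) (xs m)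
          - α / N * ((ζ k).2 - netOutput σ (sgd σ α θ₀ ζ k) (ζ k).1) *
            (1 / N * ∑ i, tangentKernel σ (xs m) (ζ k).1 (θ₀ i))| ≤ C / (N * √(N : ℝ)) := by
  obtain ⟨B, hB0, hd, -, hb, hb1, hL, hL1⟩ := hσ.exists_bounds
  set X : ℝ := ∑ m, ‖xs m‖
  set Y : ℝ := ∑ m, |ys m|
  have hX : ∀ m, ‖xs m‖ ≤ X := fun m =>
    Finset.single_le_sum (f := fun m => ‖xs m‖) (fun _ _ => norm_nonneg _) (Finset.mem_univ m)
  have hY : ∀ m, |ys m| ≤ Y := fun m =>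
    Finset.single_le_sum (f := fun m => |ys m|) (fun _ _ => abs_nonneg _) (Finset.mem_univ m)
  have hX0 : 0 ≤ X := Finset.sum_nonneg fun _ _ => norm_nonneg _
  have hY0 : 0 ≤ Y := Finset.sum_nonneg fun _ _ => abs_nonneg _
  -- The coefficients may grow by at most 1: the requirement C ≤ √N will keep the total displacement
  -- c T / √N below 1.
  set K' : ℝ := |K| + 1 with hK'
  have hK'0 : 0 ≤ K' := by positivity
  set b : ℝ := |α| * (B ^ 2 + K' ^ 2 * B ^ 2 * X ^ 2) with hbdef
  have hb0 : 0 ≤ b := by positivity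
  set U : ℝ := (Y + |R|) * Real.exp (b * T) with hU
  have hU0 : 0 ≤ U := by positivity
  set c : ℝ := |α| * U * (B + K' * B * X) with hc
  have hc0 : 0 ≤ c := by positivity
  set Λ : ℝ := 2 * B ^ 2 * X + (2 * K' * B ^ 2 + 2 * K' ^ 2 * B ^ 2 * X) * X ^ 2 with hΛ
  have hΛ0 : 0 ≤ Λ := by positivity
  set D : ℝ := α ^ 2 * U ^ 2 * (B ^ 3 * K' * X ^ 2 + K' ^ 3 * B ^ 3 * X ^ 4) with hD
  have hD0 : 0 ≤ D := by positivity
  set C₁ : ℝ := |α| * U * (Λ * (c * T)) + D with hC₁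
  have hC₁0 : 0 ≤ C₁ := by positivity
  have hcT : 0 ≤ c * T := by positivity
  have hbU : 0 ≤ b * U := by positivity
  -- One summand for each conclusion: displacement, size of the outputs, their increments, and the
  -- linearisation error.
  refine ⟨c * T + U + b * U + C₁, by positivity, ?_⟩
  intro N _ hN θ₀ hK hR ζ hζ
  have hN0 : (0 : ℝ) < N := natCast_pos_of_neZero N
  have hsN : 0 < √(N : ℝ) := Real.sqrt_pos.2 hN0
  set θ : ℕ → Fin N → ParamSpace d := sgd σ α θ₀ ζ with hθdef
  have hθs : ∀ k, θ (k + 1) = sgdStep σ (α / N) (θ k) (ζ k) := fun k => rfl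
  -- Envelope for the residuals: it satisfies v (k+1) = (1 + b/N) v k, the growth allowed by one
  -- step, and stays below U up to step N T.
  set v : ℕ → ℝ := fun k => (Y + |R|) * (1 + b / N) ^ k with hvdef
  have hvU : ∀ k : ℕ, (k : ℝ) ≤ N * T → v k ≤ U := by
    intro k hk
    have h1 : (1 + b / N) ^ k ≤ Real.exp (b * T) :=
      calc (1 + b / N) ^ k ≤ Real.exp (b / N) ^ k := by
            gcongr
            linarith [Real.add_one_le_exp (b / N)]
        _ = Real.exp (k * (b / N)) := (Real.exp_nat_mul _ _).symm
        _ ≤ Real.exp (b * T) := by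
            refine Real.exp_le_exp.2 ?_
            calc k * (b / N) ≤ (N * T) * (b / N) := by gcongr
              _ = b * T := by field_simp
    exact mul_le_mul_of_nonneg_left h1 (by positivity)
  have hζx : ∀ k, ‖(ζ k).1‖ ≤ X := fun k => by
    obtain ⟨m, hm⟩ := hζ k
    rw [hm]
    exact hX m
  have hdist : ∀ k : ℕ, (k : ℝ) ≤ N * T → k * (c / (N * √(N : ℝ))) ≤ c * T / √(N : ℝ) := by
    intro k hk
    calc k * (c / (N * √(N : ℝ))) ≤ (N * T) * (c / (N * √(N : ℝ))) := by gcongr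
      _ = c * T / √(N : ℝ) := by field_simp
  have hone : c * T / √(N : ℝ) ≤ 1 := (div_le_one hsN).2 (by linarith)
  have hcoef : ∀ k : ℕ, (k : ℝ) ≤ N * T → (∀ i, ‖θ k i - θ₀ i‖ ≤ k * (c / (N * √(N : ℝ)))) →
      ∀ i, |(θ k i).1| ≤ K' := by
    intro k hk h i
    have h1 : |(θ k i).1 - (θ₀ i).1| ≤ 1 :=
      (norm_fst_le (θ k i - θ₀ i)).trans ((h i).trans ((hdist k hk).trans hone))
    have h2 := abs_sub_abs_le_abs_sub (θ k i).1 (θ₀ i).1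
    have h3 := (hK i).trans (le_abs_self K)
    rw [hK']
    linarith
  have hres : ∀ k : ℕ, (∀ m, |netOutput σ (θ k) (xs m)| + Y ≤ v k) →
      |(ζ k).2 - netOutput σ (θ k) (ζ k).1| ≤ v k := by
    intro k h
    obtain ⟨m, hm⟩ := hζ k
    rw [hm]
    exact (abs_sub _ _).trans (by linarith [h m, hY m])
  -- The two bounds need a joint induction: the growth of the outputs requires bounded coefficients,
  -- and the displacement of the coefficients requires bounded residuals.
  have main : ∀ k : ℕ, (k : ℝ) ≤ N * T → (∀ m, |netOutput σ (θ k) (xs m)| + Y ≤ v k) ∧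
      ∀ i, ‖θ k i - θ₀ i‖ ≤ k * (c / (N * √(N : ℝ))) := by
    intro k
    induction k with
    | zero =>
      intro _
      refine ⟨fun m => ?_, fun i => ?_⟩
      · have h1 : |netOutput σ (θ 0) (xs m)| ≤ R := hR m
        simp only [hvdef, pow_zero, mul_one]
        linarith [le_abs_self R]
      · simp [hθdef, sgd]
    | succ k ih =>
      intro hk
      have hk' : (k : ℝ) ≤ N * T := le_trans (by push_cast; linarith) hk
      obtain ⟨h1, h2⟩ := ih hk'
      have h3 := hcoef k hk' h2
      have h4 := hres k h1
      refine ⟨fun m => ?_, fun i => ?_⟩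
      · have h5 := abs_netOutput_sgdStep_sub_le (α := α) hB0 hb hb1 hL (hX m) (hζx k) h3 h4
        rw [← hθs k] at h5
        have h6 := abs_sub_abs_le_abs_sub (netOutput σ (θ (k + 1)) (xs m))
          (netOutput σ (θ k) (xs m))
        have h7 : v (k + 1) = v k + b / N * v k := by
          simp only [hvdef]
          ring
        rw [h7]
        linarith [h1 m]
      · have h5 := norm_sgdStep_sub_le (α := α) hB0 hb hb1 (hζx k) h3 (h4.trans (hvU k hk')) i
        rw [← hθs k] at h5
        calc ‖θ (k + 1) i - θ₀ i‖ = ‖(θ (k + 1) i - θ k i) + (θ k i - θ₀ i)‖ := by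
              rw [sub_add_sub_cancel]
          _ ≤ c / (N * √(N : ℝ)) + k * (c / (N * √(N : ℝ))) :=
              (norm_add_le _ _).trans (add_le_add h5 (h2 i))
          _ = _ := by push_cast; ring
  intro k hk
  obtain ⟨h1, h2⟩ := main k hk
  have h3 := hcoef k hk h2
  have h4 := (hres k h1).trans (hvU k hk)
  refine ⟨fun i => ?_, fun m => ?_, fun m => ?_, fun m => ?_⟩
  · refine (h2 i).trans ((hdist k hk).trans ?_)
    gcongr
    linarith
  · linarith [h1 m, hvU k hk]
  · rw [hθs k]
    refine (abs_netOutput_sgdStep_sub_le (α := α) hB0 hb hb1 hL (hX m) (hζx k) h3 h4).trans ?_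
    rw [← hbdef, div_mul_eq_mul_div]
    gcongr
    linarith
  · rw [hθs k]
    have h5 := abs_netOutput_sgdStep_sub_sub_le (α := α) hB0 hd hb hb1 hL hL1 (hX m) (hζx k) hK'0
      h3 h4
    rw [← hD] at h5
    -- The kernel at step k is replaced by the kernel at initialisation; by its Lipschitz bound this
    -- costs O(N^{-1/2}) per unit.
    have h6 : |(∑ i, tangentKernel σ (xs m) (ζ k).1 (θ k i)) -
        ∑ i, tangentKernel σ (xs m) (ζ k).1 (θ₀ i)| ≤ N * (Λ * (c * T / √(N : ℝ))) := by
      rw [← Finset.sum_sub_distrib]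
      refine (Finset.abs_sum_le_sum_abs _ _).trans ?_
      have e : N * (Λ * (c * T / √(N : ℝ))) = ∑ _i : Fin N, Λ * (c * T / √(N : ℝ)) := by simp
      rw [e]
      refine Finset.sum_le_sum fun i _ => ?_
      refine (abs_tangentKernel_sub_le hb hb1 hL hL1 hB0 (hX m) (hζx k) (h3 i)
        (((hK i).trans (le_abs_self K)).trans (by rw [hK']; linarith))).trans ?_
      exact mul_le_mul_of_nonneg_left ((h2 i).trans (hdist k hk)) hΛ0
    have h7 : |α / N * ((ζ k).2 - netOutput σ (θ k) (ζ k).1) *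
          (1 / N * ∑ i, tangentKernel σ (xs m) (ζ k).1 (θ k i)) -
        α / N * ((ζ k).2 - netOutput σ (θ k) (ζ k).1) *
          (1 / N * ∑ i, tangentKernel σ (xs m) (ζ k).1 (θ₀ i))| ≤
        |α| * U * (Λ * (c * T)) / (N * √(N : ℝ)) := by
      rw [← mul_sub, ← mul_sub, abs_mul, abs_mul, abs_mul, abs_div, abs_div, Nat.abs_cast, abs_one]
      calc |α| / N * |(ζ k).2 - netOutput σ (θ k) (ζ k).1| * (1 / N *
            |(∑ i, tangentKernel σ (xs m) (ζ k).1 (θ k i)) -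
              ∑ i, tangentKernel σ (xs m) (ζ k).1 (θ₀ i)|)
          ≤ |α| / N * U * (1 / N * (N * (Λ * (c * T / √(N : ℝ))))) := by gcongr
        _ = _ := by field_simp
    calc _ ≤ D / (N * √(N : ℝ)) + |α| * U * (Λ * (c * T)) / (N * √(N : ℝ)) := by
          refine le_trans ?_ (add_le_add h5 h7)
          refine le_trans (le_of_eq ?_) (abs_add_le _ _)
          congr 1
          ring
      _ = C₁ / (N * √(N : ℝ)) := by rw [hC₁]; ring
      _ ≤ _ := by
          gcongr
          linarith

/-! ### Weights of the data points -/

open Classical in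
/-- The indicator that `p` is the data point `m`, divided by the multiplicity of that point. -/
noncomputable def dataWeight {ι D : Type*} [Fintype ι] (pt : ι → D) (m : ι) (p : D) : ℝ :=
  if pt m = p then ((Finset.univ.filter fun m' => pt m' = pt m).card : ℝ)⁻¹ else 0

open Classical in
theorem card_filter_eq_pos {ι D : Type*} [Fintype ι] (pt : ι → D) (m : ι) :
    (0 : ℝ) < (Finset.univ.filter fun m' => pt m' = pt m).card :=
  Nat.cast_pos.2 (Finset.card_pos.2 ⟨m, by simp⟩)

/-- Data points may coincide, so a sample need not determine its index. Dividing by the multiplicity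
makes the weights recover the value at the sample and gives every index the same mean weight 1/M
under π. -/
theorem sum_dataWeight_mul {ι D : Type*} [Fintype ι] (pt : ι → D) (f : D → ℝ) (m₀ : ι) :
    ∑ m, dataWeight pt m (pt m₀) * f (pt m) = f (pt m₀) := by
  classical
  have h : ∀ m, dataWeight pt m (pt m₀) * f (pt m) = if pt m = pt m₀ then
      ((Finset.univ.filter fun m' => pt m' = pt m₀).card : ℝ)⁻¹ * f (pt m₀) else 0 := by
    intro m
    rw [dataWeight]
    split_ifs with hm
    · rw [hm]
    · rw [zero_mul]
  simp only [h]
  rw [← Finset.sum_filter, Finset.sum_const, nsmul_eq_mul, ← mul_assoc,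
    mul_inv_cancel₀ (card_filter_eq_pos pt m₀).ne', one_mul]

theorem sum_dataWeight {ι D : Type*} [Fintype ι] (pt : ι → D) (m : ι) :
    ∑ m', dataWeight pt m (pt m') = 1 := by
  classical
  simp only [dataWeight, eq_comm (a := pt m)]
  rw [← Finset.sum_filter, Finset.sum_const, nsmul_eq_mul,
    mul_inv_cancel₀ (card_filter_eq_pos pt m).ne']

/-! ### Norm and coordinates in Euclidean space -/

theorem EuclideanSpace.norm_le_card_mul {ι : Type*} [Fintype ι] {v : EuclideanSpace ℝ ι} {c : ℝ}
    (h : ∀ i, |v i| ≤ c) : ‖v‖ ≤ Fintype.card ι * c := by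
  rcases isEmpty_or_nonempty ι with hι | ⟨⟨i₀⟩⟩
  · simp [EuclideanSpace.norm_eq]
  have hc : 0 ≤ c := (abs_nonneg _).trans (h i₀)
  have hcard : (1 : ℝ) ≤ Fintype.card ι := by
    exact_mod_cast Fintype.card_pos_iff.2 ⟨i₀⟩
  rw [EuclideanSpace.norm_eq]
  refine Real.sqrt_le_iff.2 ⟨by positivity, ?_⟩
  calc ∑ i, ‖v i‖ ^ 2 ≤ ∑ _i : ι, c ^ 2 := by
        gcongr with i
        exact h i
    _ = Fintype.card ι * c ^ 2 := by simp
    _ ≤ (Fintype.card ι * c) ^ 2 := by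
        rw [mul_pow]
        gcongr
        nlinarith

theorem EuclideanSpace.abs_apply_le_norm {ι : Type*} [Fintype ι] (v : EuclideanSpace ℝ ι) (i : ι) :
    |v i| ≤ ‖v‖ := PiLp.norm_apply_le v i

/-! ### Comparison of the outputs with the limiting flow -/

section Comparison

variable {d M : ℕ}

/-- The matrix of the limit equation as a continuous linear map. -/
noncomputable def limitOperator (σ : ℝ → ℝ) (α : ℝ) (μ : Measure (ParamSpace d))
    (xs : Fin M → EuclideanSpace ℝ (Fin d)) : EuclideanSpace ℝ (Fin M) →L[ℝ] EuclideanSpace ℝ (Fin M) :=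
  Matrix.toEuclideanCLM (𝕜 := ℝ) (limitMatrix σ α μ xs)

theorem limitOperator_apply (σ : ℝ → ℝ) (α : ℝ) (μ : Measure (ParamSpace d))
    (xs : Fin M → EuclideanSpace ℝ (Fin d)) (v : EuclideanSpace ℝ (Fin M)) (m : Fin M) :
    limitOperator σ α μ xs v m = ∑ m', limitMatrix σ α μ xs m m' * v m' := by
  simp [limitOperator, Matrix.mulVec, dotProduct]

/-- The drift produced by the data point `m`. -/
noncomputable def dataDrift (σ : ℝ → ℝ) (α : ℝ) (μ : Measure (ParamSpace d))
    (xs : Fin M → EuclideanSpace ℝ (Fin d)) (ys : Fin M → ℝ) (m : Fin M)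
    (u : EuclideanSpace ℝ (Fin M)) : EuclideanSpace ℝ (Fin M) :=
  (ys m - u m) • WithLp.toLp 2 fun m' => α * limitKernel σ μ (xs m') (xs m)

theorem sum_dataDrift (σ : ℝ → ℝ) (α : ℝ) (μ : Measure (ParamSpace d))
    (xs : Fin M → EuclideanSpace ℝ (Fin d)) (ys : Fin M → ℝ) (u : EuclideanSpace ℝ (Fin M)) :
    ∑ m, (1 / (M : ℝ)) • dataDrift σ α μ xs ys m u =
      limitOperator σ α μ xs (WithLp.toLp 2 ys - u) := by
  ext m'
  rw [limitOperator_apply]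
  simp only [dataDrift, limitMatrix, WithLp.ofLp_sum, Finset.sum_apply, PiLp.smul_apply,
    smul_eq_mul, PiLp.sub_apply, Matrix.of_apply]
  exact Finset.sum_congr rfl fun m _ => by ring

/-- The deterministic core. Initial parameters and samples enter only through size bounds and the
ε-closeness of the kernel averages and of the sample frequencies to their limits; Q depends on none
of these realisations, nor on N or ε. It is the averaging principle with step 1/N, applied to the
outputs and to the flow sampled at times k/N. -/
theorem exists_dataOutput_sub_linearFlow_le (hM : 0 < M) {σ : ℝ → ℝ} (hσ : IsCb2 σ) (α K R : ℝ)
    {T : ℝ} (hT : 0 ≤ T) (xs : Fin M → EuclideanSpace ℝ (Fin d)) (ys : Fin M → ℝ)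
    (μ : Measure (ParamSpace d)) :
    ∃ Q : ℝ, 0 ≤ Q ∧ ∀ ε : ℝ, 0 < ε → ∀ (N : ℕ) [NeZero N], Q ≤ √(N : ℝ) → 1 / √(N : ℝ) ≤ ε →
      ∀ θ₀ : Fin N → ParamSpace d,
      (∀ i, |(θ₀ i).1| ≤ K) → (∀ m, |netOutput σ θ₀ (xs m)| ≤ R) →
      ∀ ζ : ℕ → EuclideanSpace ℝ (Fin d) × ℝ, (∀ k, ∃ m, ζ k = (xs m, ys m)) →
      (∀ m m', |1 / (N : ℝ) * ∑ i, tangentKernel σ (xs m) (xs m') (θ₀ i)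
        - limitKernel σ μ (xs m) (xs m')| ≤ ε) →
      (∀ m, ∀ k : ℕ, (k : ℝ) ≤ N * T →
        |∑ j ∈ Finset.range k, (dataWeight (fun m => (xs m, ys m)) m (ζ j) - 1 / (M : ℝ))|
          ≤ ε * N) →
      ∀ k : ℕ, (k : ℝ) ≤ N * T →
        (∀ i, ‖sgd σ α θ₀ ζ k i - θ₀ i‖ ≤ Q * ε) ∧
        ‖dataOutput σ xs (sgd σ α θ₀ ζ k) - linearFlow (limitOperator σ α μ xs)
          (WithLp.toLp 2 ys) (dataOutput σ xs θ₀) (k / N)‖ ≤ Q * ε := by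
  obtain ⟨C, hC0, hC⟩ := exists_sgd_bounds hσ α K R hT xs ys
  set A := limitOperator σ α μ xs with hA
  set y : EuclideanSpace ℝ (Fin M) := WithLp.toLp 2 ys with hy
  -- The horizon T + 1 leaves room for the endpoint (k + 1)/N of an Euler step.
  obtain ⟨Cf, hCf0, hCf⟩ := exists_linearFlow_bounds A y (T + 1) (M * |R|)
  set Y : ℝ := ∑ m, |ys m|
  have hY : ∀ m, |ys m| ≤ Y := fun m =>
    Finset.single_le_sum (f := fun m => |ys m|) (fun _ _ => abs_nonneg _) (Finset.mem_univ m)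
  have hY0 : 0 ≤ Y := Finset.sum_nonneg fun _ _ => abs_nonneg _
  set κ : Fin M → EuclideanSpace ℝ (Fin M) :=
    fun m => WithLp.toLp 2 fun m' => α * limitKernel σ μ (xs m') (xs m) with hκ
  set L : ℝ := ∑ m, ‖κ m‖
  have hL : ∀ m, ‖κ m‖ ≤ L := fun m =>
    Finset.single_le_sum (f := fun m => ‖κ m‖) (fun _ _ => norm_nonneg _) (Finset.mem_univ m)
  have hL0 : 0 ≤ L := Finset.sum_nonneg fun _ _ => norm_nonneg _
  set D : ℝ := M * (C + |α| * (Y + C)) with hD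
  have hD0 : 0 ≤ D := by positivity
  set Q₁ : ℝ := (M * ((Y + C) * L + T * (L * (M * C))) + T * (D + Cf)) * Real.exp (L * T) with hQ₁
  have hQ₁0 : 0 ≤ Q₁ := by positivity
  refine ⟨C + Q₁, by positivity, ?_⟩
  intro ε hε N _ hN hNε θ₀ hK hR ζ hζ hker hcnt k hk
  have hN0 : (0 : ℝ) < N := natCast_pos_of_neZero N
  have hN1 : (1 : ℝ) ≤ N := by exact_mod_cast NeZero.one_le
  have hsN : 0 < √(N : ℝ) := Real.sqrt_pos.2 hN0
  have hb := hC N (by linarith) θ₀ hK hR ζ hζ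
  have hNinv : 1 / (N : ℝ) ≤ ε := by
    refine le_trans ?_ hNε
    exact one_div_le_one_div_of_le hsN (Real.sqrt_le_iff.2 ⟨hN0.le, by nlinarith⟩)
  refine ⟨fun i => ((hb k hk).1 i).trans ?_, ?_⟩
  · rw [div_eq_mul_one_div]
    calc C * (1 / √(N : ℝ)) ≤ C * ε := by gcongr
      _ ≤ _ := by nlinarith
  set u : ℕ → EuclideanSpace ℝ (Fin M) := fun k => dataOutput σ xs (sgd σ α θ₀ ζ k) with hu
  set h : ℕ → EuclideanSpace ℝ (Fin M) := fun k => linearFlow A y (dataOutput σ xs θ₀) (k / N)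
    with hh
  have hum : ∀ k m, u k m = netOutput σ (sgd σ α θ₀ ζ k) (xs m) := fun k m => rfl
  set n : ℕ := ⌊(N : ℝ) * T⌋₊ with hn
  have hNT : 0 ≤ (N : ℝ) * T := by positivity
  have hle : ∀ {k : ℕ}, k ≤ n → (k : ℝ) ≤ N * T := fun hk => (Nat.le_floor_iff hNT).1 hk
  have hna : (n : ℝ) * (1 / N) ≤ T := by
    rw [mul_one_div, div_le_iff₀ hN0, mul_comm]
    exact Nat.floor_le hNT
  set F := dataDrift σ α μ xs ys with hF
  set w := dataWeight (fun m => (xs m, ys m)) with hw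
  have hg0 : ‖dataOutput σ xs θ₀‖ ≤ M * |R| := by
    have := EuclideanSpace.norm_le_card_mul (v := dataOutput σ xs θ₀) (c := |R|)
      fun m => (hR m).trans (le_abs_self R)
    simpa using this
  -- Both remainders are defined as whatever the recursions leave over, so the recursions hold
  -- trivially. The work is to bound them: linearisation and kernel error for u, Euler error for h.
  have havg := norm_sub_le_of_averaging (ι := Fin M) F u h
    (fun k => u (k + 1) - u k - (1 / (N : ℝ)) • ∑ m, w m (ζ k) • F m (u k))
    (fun k => h (k + 1) - h k - (1 / (N : ℝ)) • ∑ m, (1 / (M : ℝ)) • F m (h k))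
    (fun k m => w m (ζ k)) (fun _ => 1 / (M : ℝ)) (n := n) (a := 1 / (N : ℝ)) (L := L)
    (B := (Y + C) * L) (c := M * C) (s := ε * N) (δ := D * ε) (δ' := Cf * ε)
    (by positivity) hL0 (by positivity) (by positivity) (by positivity) (by positivity)
    (fun _ => by positivity) (by simp [hM.ne']) (fun k _ => by abel) (fun k _ => by abel)
    (by simp [hu, hh, linearFlow_zero, sgd]) ?_ ?_ ?_ ?_ ?_ (fun m k hk => hcnt m k (hle hk))
    (k := k) ((Nat.le_floor_iff hNT).2 hk)
  · refine havg.trans ?_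
    calc _ ≤ (M * (ε * ((Y + C) * L + T * (L * (M * C)))) + T * (D * ε + Cf * ε)) *
          Real.exp (L * T) := by
          have e1 : 1 / (N : ℝ) * (ε * N) = ε := by field_simp
          rw [Fintype.card_fin, e1]
          gcongr
      _ = Q₁ * ε := by rw [hQ₁]; ring
      _ ≤ _ := by nlinarith
  · intro k hk
    have hk' := hle hk.le
    obtain ⟨-, b2, -, b4⟩ := hb k hk'
    have e : ∀ c : ℝ, c = M * (1 / N * ((C + |α| * (Y + C)) * ε)) → c = 1 / N * (D * ε) := by
      rintro c rfl
      rw [hD]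
      ring
    rw [← e _ rfl]
    have := EuclideanSpace.norm_le_card_mul (ι := Fin M)
      (v := u (k + 1) - u k - (1 / (N : ℝ)) • ∑ m, w m (ζ k) • F m (u k))
      (c := 1 / N * ((C + |α| * (Y + C)) * ε)) ?_
    · simpa using this
    intro m
    obtain ⟨m₀, hm₀⟩ := hζ k
    -- The weights select the sampled data point, so the weighted drift is the limit-kernel drift of
    -- that sample.
    have hsum : (∑ m', w m' (ζ k) • F m' (u k)) m =
        ((ζ k).2 - netOutput σ (sgd σ α θ₀ ζ k) (ζ k).1) *
          (α * limitKernel σ μ (xs m) (ζ k).1) := by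
      have := sum_dataWeight_mul (fun m => (xs m, ys m))
        (fun p => (p.2 - netOutput σ (sgd σ α θ₀ ζ k) p.1) *
          (α * limitKernel σ μ (xs m) p.1)) m₀
      rw [← hm₀] at this
      rw [← this]
      simp only [WithLp.ofLp_sum, Finset.sum_apply, PiLp.smul_apply, smul_eq_mul, hF, dataDrift,
        hum, hw]
    rw [PiLp.sub_apply, PiLp.sub_apply, PiLp.smul_apply, hsum, hum, hum, smul_eq_mul]
    have h1 := b4 m
    have h2 : |(ζ k).2 - netOutput σ (sgd σ α θ₀ ζ k) (ζ k).1| ≤ Y + C := by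
      rw [hm₀]
      exact (abs_sub _ _).trans (add_le_add (hY m₀) (b2 m₀))
    have h3 : |1 / (N : ℝ) * ∑ i, tangentKernel σ (xs m) (ζ k).1 (θ₀ i)
        - limitKernel σ μ (xs m) (ζ k).1| ≤ ε := by
      rw [hm₀]
      exact hker m m₀
    set ρ := (ζ k).2 - netOutput σ (sgd σ α θ₀ ζ k) (ζ k).1
    set τ := 1 / (N : ℝ) * ∑ i, tangentKernel σ (xs m) (ζ k).1 (θ₀ i)
    set l := limitKernel σ μ (xs m) (ζ k).1
    have h4 : |α / N * ρ * (τ - l)| ≤ |α| / N * (Y + C) * ε := by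
      rw [abs_mul, abs_mul, abs_div, Nat.abs_cast]
      gcongr
    have h5 : C / (N * √(N : ℝ)) ≤ 1 / N * (C * ε) := by
      calc C / (N * √(N : ℝ)) = 1 / N * (C * (1 / √(N : ℝ))) := by field_simp
        _ ≤ _ := by gcongr
    calc _ = |(netOutput σ (sgd σ α θ₀ ζ (k + 1)) (xs m) - netOutput σ (sgd σ α θ₀ ζ k) (xs m)
            - α / N * ρ * τ) + α / N * ρ * (τ - l)| := by
          congr 1
          ring
      _ ≤ 1 / N * (C * ε) + |α| / N * (Y + C) * ε :=
          (abs_add_le _ _).trans (add_le_add (h1.trans h5) h4)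
      _ = _ := by ring
  · intro k hk
    have hk' := hle hk.le
    rw [sum_dataDrift]
    have hkN : (k : ℝ) / N ≤ T := by
      rw [div_le_iff₀ hN0, mul_comm]
      exact hk'
    have e1 : ((k + 1 : ℕ) : ℝ) / N = k / N + 1 / N := by push_cast; ring
    have h1N : 1 / (N : ℝ) ≤ 1 := (div_le_one hN0).2 hN1
    have := (hCf _ hg0 (k / N) ⟨by positivity, by linarith⟩ (((k + 1 : ℕ) : ℝ) / N)
      ⟨by positivity, by rw [e1]; linarith⟩ (by rw [e1]; linarith [one_div_pos.2 hN0])).2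
    rw [e1, add_sub_cancel_left, ← e1] at this
    refine this.trans ?_
    rw [sq, mul_left_comm]
    gcongr
  · intro m v v'
    have e : F m v - F m v' = (v' - v) m • κ m := by
      rw [PiLp.sub_apply]
      simp only [hF, dataDrift, hκ]
      module
    rw [e, norm_smul, mul_comm L, ← norm_neg (v - v'), neg_sub]
    exact mul_le_mul (EuclideanSpace.abs_apply_le_norm _ _) (hL m) (norm_nonneg _) (norm_nonneg _)
  · intro m k hk
    rw [hF, dataDrift, norm_smul]
    refine mul_le_mul ?_ (hL m) (norm_nonneg _) (by positivity)
    exact (abs_sub _ _).trans (add_le_add (hY m) ((hb k (hle hk)).2.1 m))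
  · intro k hk
    have := EuclideanSpace.norm_le_card_mul (v := u (k + 1) - u k) (c := C / N)
      fun m => (hb k (hle hk.le)).2.2.1 m
    refine this.trans (le_of_eq ?_)
    rw [Fintype.card_fin]
    ring

end Comparison

/-! ### The limit path -/

section LimitPath

variable {d M : ℕ} {T : ℝ}

theorem isCadlag_linearFlow {V X : Type*} [NormedAddCommGroup V] [NormedSpace ℝ V]
    [CompleteSpace V] [TopologicalSpace X] (T : ℝ) (A : V →L[ℝ] V) (y g : V) (c : X) :
    IsCadlag (T := T) fun t => (c, linearFlow A y g t) :=
  IsCadlag.of_continuous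
    (continuous_const.prodMk ((continuous_linearFlow A y g).comp continuous_subtype_val))

/-- The path `t ↦ (μ₀, h_t)` with `h` the linear flow `h' = A (y - h)` started from `g`. -/
noncomputable def flowPath (T : ℝ) (A : EuclideanSpace ℝ (Fin M) →L[ℝ] EuclideanSpace ℝ (Fin M))
    (y : EuclideanSpace ℝ (Fin M)) (μ₀ : ProbabilityMeasure (ParamSpace d))
    (g : EuclideanSpace ℝ (Fin M)) : SkorokhodSpace T (StateSpace d M) where
  toFun t := (LevyProkhorov.ofMeasure μ₀, linearFlow A y g t)
  cadlag := isCadlag_linearFlow T A y g (LevyProkhorov.ofMeasure μ₀)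

/-- Two flows differ by exp(-tA)(g - g'), so the path is Lipschitz in its start, uniformly on [0,
T]. This is the input for the continuous mapping theorem. -/
theorem continuous_flowPath (A : EuclideanSpace ℝ (Fin M) →L[ℝ] EuclideanSpace ℝ (Fin M))
    (y : EuclideanSpace ℝ (Fin M)) (μ₀ : ProbabilityMeasure (ParamSpace d)) :
    Continuous (flowPath T A y μ₀) := by
  obtain ⟨C, hC0, hC⟩ := exists_norm_exp_smul_neg_le A T
  refine LipschitzWith.continuous (K := C.toNNReal) fun g g' => ?_
  refine (SkorokhodSpace.edist_le_iSup _ _).trans (iSup_le fun t => ?_)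
  rw [Prod.edist_eq]
  refine max_le ?_ ?_
  · show edist (LevyProkhorov.ofMeasure μ₀) (LevyProkhorov.ofMeasure μ₀) ≤ _
    rw [edist_self]
    exact bot_le
  · show edist (linearFlow A y g t) (linearFlow A y g' t) ≤ _
    rw [edist_dist, edist_dist, dist_eq_norm, dist_eq_norm, linearFlow_sub_linearFlow,
      ← ENNReal.ofReal_coe_nnreal, Real.coe_toNNReal _ hC0, ← ENNReal.ofReal_mul hC0]
    refine ENNReal.ofReal_le_ofReal ((ContinuousLinearMap.le_opNorm _ _).trans ?_)
    exact mul_le_mul_of_nonneg_right (hC t t.2) (norm_nonneg _)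

theorem eval_flowPath (hT : 0 ≤ T) (A : EuclideanSpace ℝ (Fin M) →L[ℝ] EuclideanSpace ℝ (Fin M))
    (y : EuclideanSpace ℝ (Fin M)) (μ₀ : ProbabilityMeasure (ParamSpace d))
    (g : EuclideanSpace ℝ (Fin M)) {t : ℝ} (ht : t ∈ Set.Icc 0 T) :
    (flowPath T A y μ₀ g).eval hT t = (LevyProkhorov.ofMeasure μ₀, linearFlow A y g t) := by
  rw [SkorokhodSpace.eval_of_mem hT _ ht]
  rfl

/-- The solution of the limit equations with initial values `μ₀` and `g`. -/
noncomputable def limitPath (T : ℝ) (σ : ℝ → ℝ) (α : ℝ) (xs : Fin M → EuclideanSpace ℝ (Fin d))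
    (ys : Fin M → ℝ) (μ₀ : ProbabilityMeasure (ParamSpace d)) (g : EuclideanSpace ℝ (Fin M)) :
    SkorokhodSpace T (StateSpace d M) :=
  flowPath T (limitOperator σ α μ₀ xs) (WithLp.toLp 2 ys) μ₀ g

theorem limitPath_eval_fst (hT : 0 ≤ T) (σ : ℝ → ℝ) (α : ℝ)
    (xs : Fin M → EuclideanSpace ℝ (Fin d)) (ys : Fin M → ℝ)
    (μ₀ : ProbabilityMeasure (ParamSpace d)) (g : EuclideanSpace ℝ (Fin M)) (t : ℝ) :
    ((limitPath T σ α xs ys μ₀ g).eval hT t).1.toMeasure = μ₀ := rfl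

theorem limitPath_eval_snd (hT : 0 ≤ T) (σ : ℝ → ℝ) (α : ℝ)
    (xs : Fin M → EuclideanSpace ℝ (Fin d)) (ys : Fin M → ℝ)
    (μ₀ : ProbabilityMeasure (ParamSpace d)) (g : EuclideanSpace ℝ (Fin M)) {t : ℝ}
    (ht : t ∈ Set.Icc 0 T) : ((limitPath T σ α xs ys μ₀ g).eval hT t).2 =
      linearFlow (limitOperator σ α μ₀ xs) (WithLp.toLp 2 ys) g t := by
  rw [limitPath, eval_flowPath hT _ _ _ _ ht]

theorem continuous_limitPath (σ : ℝ → ℝ) (α : ℝ) (xs : Fin M → EuclideanSpace ℝ (Fin d))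
    (ys : Fin M → ℝ) (μ₀ : ProbabilityMeasure (ParamSpace d)) :
    Continuous (limitPath T σ α xs ys μ₀) :=
  continuous_flowPath _ _ _

theorem hasDerivAt_linearFlow_apply (σ : ℝ → ℝ) (α : ℝ) (μ₀ : Measure (ParamSpace d))
    (xs : Fin M → EuclideanSpace ℝ (Fin d)) (ys : Fin M → ℝ) (g : EuclideanSpace ℝ (Fin M))
    (t : ℝ) (m : Fin M) :
    HasDerivAt (fun s => linearFlow (limitOperator σ α μ₀ xs) (WithLp.toLp 2 ys) g s m)
      (∑ m', limitMatrix σ α μ₀ xs m m' *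
        (ys m' - linearFlow (limitOperator σ α μ₀ xs) (WithLp.toLp 2 ys) g t m')) t := by
  have h := (EuclideanSpace.proj (𝕜 := ℝ) m).hasFDerivAt.comp_hasDerivAt t
    (hasDerivAt_linearFlow (limitOperator σ α μ₀ xs) (WithLp.toLp 2 ys) g t)
  have e := limitOperator_apply σ α μ₀ xs
    (WithLp.toLp 2 ys - linearFlow (limitOperator σ α μ₀ xs) (WithLp.toLp 2 ys) g t) m
  simp only [PiLp.sub_apply] at e
  rw [← e]
  exact h

theorem drift_eq_sum_limitMatrix (σ : ℝ → ℝ) (α : ℝ) (μ : Measure (ParamSpace d))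
    (xs : Fin M → EuclideanSpace ℝ (Fin d)) (ys : Fin M → ℝ) (u : Fin M → ℝ) (m : Fin M) :
    α * ((1 / (M : ℝ)) * ∑ m', (ys m' - u m') * limitKernel σ μ (xs m) (xs m')) =
      ∑ m', limitMatrix σ α μ xs m m' * (ys m' - u m') := by
  rw [Finset.mul_sum, Finset.mul_sum]
  refine Finset.sum_congr rfl fun m' _ => ?_
  rw [limitMatrix, Matrix.of_apply]
  ring

theorem isLimitSolution_limitPath (hT : 0 ≤ T) (σ : ℝ → ℝ) (α : ℝ)
    (xs : Fin M → EuclideanSpace ℝ (Fin d)) (ys : Fin M → ℝ)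
    (μ₀ : ProbabilityMeasure (ParamSpace d)) (g : EuclideanSpace ℝ (Fin M)) :
    IsLimitSolution hT σ α xs ys μ₀ g (limitPath T σ α xs ys μ₀ g) := by
  refine ⟨fun f _ t _ => rfl, fun t ht m => ?_⟩
  simp only [limitPath_eval_fst]
  rw [limitPath_eval_snd hT _ _ _ _ _ _ ht, ← intervalIntegral.integral_const_mul]
  set h := linearFlow (limitOperator σ α μ₀ xs) (WithLp.toLp 2 ys) g with hh
  have e : ∫ s in (0 : ℝ)..t, α * ((1 / (M : ℝ)) * ∑ m' : Fin M,
      (ys m' - ((limitPath T σ α xs ys μ₀ g).eval hT s).2 m') *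
        limitKernel σ μ₀ (xs m) (xs m')) =
      ∫ s in (0 : ℝ)..t, ∑ m', limitMatrix σ α μ₀ xs m m' * (ys m' - h s m') := by
    refine intervalIntegral.integral_congr fun s hs => ?_
    rw [Set.uIcc_of_le ht.1] at hs
    simp only [limitPath_eval_snd hT _ _ _ _ _ _ (⟨hs.1, hs.2.trans ht.2⟩ : s ∈ Set.Icc 0 T)]
    exact drift_eq_sum_limitMatrix _ _ _ _ _ _ _
  have hc : Continuous h := continuous_linearFlow _ _ _
  have hc' : ∀ m', Continuous fun s => h s m' := fun m' =>
    (EuclideanSpace.proj (𝕜 := ℝ) m').continuous.comp hc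
  have hψ : Continuous fun s => ∑ m', limitMatrix σ α μ₀ xs m m' * (ys m' - h s m') :=
    continuous_finsetSum _ fun m' _ => continuous_const.mul (continuous_const.sub (hc' m'))
  rw [e, intervalIntegral.integral_eq_sub_of_hasDerivAt
    (fun s _ => hasDerivAt_linearFlow_apply σ α μ₀ xs ys g s m)
    (hψ.intervalIntegrable _ _), linearFlow_zero]
  ring

/-- Once μ_t is frozen, regularity is bootstrapped: a càdlàg h is bounded and measurable, so its
integral equation makes it continuous, hence right-differentiable with the linear vector field, and
uniqueness for Lipschitz ODEs applies. -/
theorem IsLimitSolution.eq_limitPath {hT : 0 ≤ T} {σ : ℝ → ℝ} {α : ℝ}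
    {xs : Fin M → EuclideanSpace ℝ (Fin d)} {ys : Fin M → ℝ}
    {μ₀ : ProbabilityMeasure (ParamSpace d)} {g : EuclideanSpace ℝ (Fin M)}
    {z : SkorokhodSpace T (StateSpace d M)} (hz : IsLimitSolution hT σ α xs ys μ₀ g z) :
    z = limitPath T σ α xs ys μ₀ g := by
  obtain ⟨h1, h2⟩ := hz
  have hμ : ∀ t ∈ Set.Icc (0 : ℝ) T, (z.eval hT t).1.toMeasure = μ₀ := fun t ht => by
    have e : ((z.eval hT t).1.toMeasure : Measure (ParamSpace d)) = μ₀ :=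
      measure_ext_of_forall_isCb2 fun f hf => h1 f hf t ht
    exact Subtype.ext e
  set h : ℝ → EuclideanSpace ℝ (Fin M) := fun t => (z.eval hT t).2 with hh
  have hint : ∀ m a b, IntervalIntegrable (fun t => h t m) volume a b := fun m a b =>
    (z.cadlag.comp ((EuclideanSpace.proj (𝕜 := ℝ) m).continuous.comp
      continuous_snd)).intervalIntegrable_extend hT a b
  set ψ : Fin M → ℝ → ℝ := fun m s => ∑ m', limitMatrix σ α μ₀ xs m m' * (ys m' - h s m') with hψ
  have hmeas : ∀ m, Measurable fun t => h t m := fun m =>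
    (z.cadlag.comp ((EuclideanSpace.proj (𝕜 := ℝ) m).continuous.comp
      continuous_snd)).measurable_extend hT
  have hψmeas : ∀ m, Measurable (ψ m) := fun m =>
    Finset.measurable_fun_sum _ fun m' _ => ((hmeas m').const_sub _).const_mul _
  have hψint : ∀ m a b, IntervalIntegrable (ψ m) volume a b := fun m a b => by
    have := IntervalIntegrable.sum (μ := volume) (a := a) (b := b) Finset.univ
      (f := fun m' s => limitMatrix σ α μ₀ xs m m' * (ys m' - h s m'))
      fun m' _ => (intervalIntegrable_const.sub (hint m' a b)).const_mul _
    simpa only [hψ, Finset.sum_fn] using this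
  have heq : ∀ t ∈ Set.Icc 0 T, ∀ m, h t m = g m + ∫ s in (0 : ℝ)..t, ψ m s := by
    intro t ht m
    rw [hh, h2 t ht m, ← intervalIntegral.integral_const_mul]
    congr 1
    refine intervalIntegral.integral_congr fun s hs => ?_
    rw [Set.uIcc_of_le ht.1] at hs
    simp only [hμ s ⟨hs.1, hs.2.trans ht.2⟩]
    exact drift_eq_sum_limitMatrix _ _ _ _ _ _ _
  have hcont : ContinuousOn h (Set.Icc 0 T) := by
    have : ContinuousOn (fun t => WithLp.toLp 2 fun m => g m + ∫ s in (0 : ℝ)..t, ψ m s)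
        (Set.Icc 0 T) := by
      have hprim := fun m => intervalIntegral.continuous_primitive (hψint m) 0
      exact ((PiLp.continuous_toLp 2 fun _ : Fin M => ℝ).comp
        (continuous_pi fun m => continuous_const.add (hprim m))).continuousOn
    refine this.congr fun t ht => ?_
    ext m
    exact heq t ht m
  set A := limitOperator σ α μ₀ xs with hA
  set y : EuclideanSpace ℝ (Fin M) := WithLp.toLp 2 ys with hy
  have hderiv : ∀ t ∈ Set.Ico 0 T, HasDerivWithinAt h (A (y - h t)) (Set.Ici t) t := by
    intro t ht
    have hcm : ∀ m', ContinuousOn (fun s => h s m') (Set.Icc 0 T) := fun m' =>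
      (EuclideanSpace.proj (𝕜 := ℝ) m').continuous.comp_continuousOn hcont
    have hψc : ∀ m, ContinuousOn (ψ m) (Set.Icc 0 T) := fun m =>
      continuousOn_finsetSum _ fun m' _ =>
        continuousOn_const.mul (continuousOn_const.sub (hcm m'))
    have hmem : Set.Icc 0 T ∈ 𝓝[≥] t :=
      mem_of_superset (Icc_mem_nhdsGE_of_mem ⟨le_rfl, ht.2⟩) (Set.Icc_subset_Icc_left ht.1)
    have hd : ∀ m, HasDerivWithinAt (fun t => g m + ∫ s in (0 : ℝ)..t, ψ m s) (ψ m t)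
        (Set.Ici t) t := fun m => by
      refine HasDerivWithinAt.const_add _ ?_
      refine intervalIntegral.integral_hasDerivWithinAt_right (hψint m 0 t) ?_ ?_
      · exact (hψmeas m).aestronglyMeasurable.stronglyMeasurableAtFilter
      · exact ((hψc m) t ⟨ht.1, ht.2.le⟩).mono_of_mem_nhdsWithin
          (mem_of_superset (nhdsWithin_mono _ Set.Ioi_subset_Ici_self hmem) subset_rfl)
    have hd2 : HasDerivWithinAt (fun t => WithLp.toLp 2 fun m => g m + ∫ s in (0 : ℝ)..t, ψ m s)
        (A (y - h t)) (Set.Ici t) t := by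
      have h3 := hasDerivWithinAt_pi.2 hd
      have h4 := (PiLp.continuousLinearEquiv 2 ℝ (fun _ : Fin M => ℝ)).symm.hasFDerivAt
        (x := fun m => g m + ∫ s in (0 : ℝ)..t, ψ m s) |>.comp_hasDerivWithinAt t h3
      have e : A (y - h t) = WithLp.toLp 2 fun m => ψ m t := by
        ext m
        rw [hA, limitOperator_apply]
        simp only [hψ, hy, PiLp.sub_apply]
      rw [e]
      exact h4
    refine hd2.congr_of_eventuallyEq ?_ ?_
    · filter_upwards [hmem] with s hs
      ext m
      exact heq s hs m
    · ext m
      exact heq t ⟨ht.1, ht.2.le⟩ m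
  have hflow : Set.EqOn h (linearFlow A y g) (Set.Icc 0 T) := by
    refine ODE_solution_unique (v := fun _ u => A (y - u)) (K := ‖A‖₊) (fun _ => ?_) hcont hderiv
      (continuous_linearFlow A y g).continuousOn
      (fun t _ => (hasDerivAt_linearFlow A y g t).hasDerivWithinAt) ?_
    · refine LipschitzWith.of_dist_le_mul fun u v => ?_
      rw [dist_eq_norm, ← map_sub, sub_sub_sub_cancel_left, dist_eq_norm, ← norm_neg (u - v),
        neg_sub]
      exact A.le_opNorm _
    · rw [linearFlow_zero]
      ext m
      rw [heq 0 ⟨le_rfl, hT⟩ m]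
      simp
  refine SkorokhodSpace.ext (funext fun t => Prod.ext ?_ ?_)
  · have := hμ t t.2
    rw [SkorokhodSpace.eval_of_mem hT _ t.2] at this
    exact LevyProkhorov.toMeasure_injective this
  · have := hflow t.2
    simp only [hh] at this
    rw [SkorokhodSpace.eval_of_mem hT _ t.2] at this
    exact this

end LimitPath

/-! ### Continuity of the rescaled path in the initial parameters and the samples -/

section Continuity

variable {d M N : ℕ}

theorem continuous_sgd {σ : ℝ → ℝ} (hσ : Continuous σ) (hσ' : Continuous (deriv σ)) (α : ℝ) (k : ℕ) :
    Continuous fun q : (Fin N → ParamSpace d) × (ℕ → EuclideanSpace ℝ (Fin d) × ℝ) =>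
      sgd σ α q.1 q.2 k := by
  induction k with
  | zero => exact continuous_fst
  | succ k ih =>
    refine continuous_pi fun i => ?_
    simp only [sgd, sgdStep, netOutput]
    have h1 : ∀ i, Continuous fun q : (Fin N → ParamSpace d) × (ℕ → EuclideanSpace ℝ (Fin d) × ℝ) =>
      sgd σ α q.1 q.2 k i := fun i => (continuous_apply i).comp ih
    have h2 : Continuous fun q : (Fin N → ParamSpace d) × (ℕ → EuclideanSpace ℝ (Fin d) × ℝ) =>
      q.2 k := (continuous_apply k).comp continuous_snd
    fun_prop

theorem continuous_dataOutput {σ : ℝ → ℝ} (hσ : Continuous σ)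
    (xs : Fin M → EuclideanSpace ℝ (Fin d)) :
    Continuous fun θ : Fin N → ParamSpace d => dataOutput σ xs θ := by
  unfold dataOutput netOutput
  fun_prop

/-- Supplies measurability of the random path for the Borel σ-algebra of the Skorokhod space. The
jump times are fixed and only the finitely many states with k ≤ N T occur, so continuity of each
state suffices. -/
theorem continuous_rescaledPath [NeZero N] (T : ℝ) {σ : ℝ → ℝ} (hσ : Continuous σ)
    (hσ' : Continuous (deriv σ)) (α : ℝ) (xs : Fin M → EuclideanSpace ℝ (Fin d)) :
    Continuous fun q : (Fin N → ParamSpace d) × (ℕ → EuclideanSpace ℝ (Fin d) × ℝ) =>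
      rescaledPath T σ α xs q.1 q.2 := by
  set S : ℕ → (Fin N → ParamSpace d) × (ℕ → EuclideanSpace ℝ (Fin d) × ℝ) → StateSpace d M :=
    fun k q => (LevyProkhorov.ofMeasure (empiricalMeasure (sgd σ α q.1 q.2 k)),
      dataOutput σ xs (sgd σ α q.1 q.2 k)) with hS
  have hSc : ∀ k, Continuous (S k) := fun k =>
    (continuous_ofMeasure_empiricalMeasure.comp (continuous_sgd hσ hσ' α k)).prodMk
      ((continuous_dataOutput hσ xs).comp (continuous_sgd hσ hσ' α k))
  refine continuous_iff_continuousAt.2 fun q => EMetric.tendsto_nhds.2 fun ε hε => ?_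
  obtain ⟨ε', hε'0, hε'⟩ := exists_between hε
  have h1 : ∀ᶠ q' in 𝓝 q, ∀ k ∈ Finset.range (⌊(N : ℝ) * T⌋₊ + 1), edist (S k q') (S k q) < ε' :=
    (Finset.eventually_all _).2 fun k _ => EMetric.tendsto_nhds.1 ((hSc k).tendsto q) ε' hε'0
  filter_upwards [h1] with q' hq'
  refine lt_of_le_of_lt ((SkorokhodSpace.edist_le_iSup _ _).trans (iSup_le fun t => ?_)) hε'
  refine (hq' ⌊(N : ℝ) * t⌋₊ ?_).le
  rw [Finset.mem_range, Nat.lt_succ_iff]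
  exact Nat.floor_le_floor (mul_le_mul_of_nonneg_left t.2.2 (Nat.cast_nonneg N))

end Continuity

/-! ### Pathwise convergence -/

section Pathwise

variable {d M : ℕ}

/-- The statement for one realisation. The bound R is imposed inside the eventuality because the
initial outputs converge only in law and need not stay bounded along the sequence. -/
theorem eventually_edist_limitPath_rescaledPath_le (hM : 0 < M) {σ : ℝ → ℝ} (hσ : IsCb2 σ)
    (α K R : ℝ) {T : ℝ} (hT : 0 ≤ T) (xs : Fin M → EuclideanSpace ℝ (Fin d)) (ys : Fin M → ℝ)
    (μ₀ : ProbabilityMeasure (ParamSpace d)) (θ : ℕ → ParamSpace d)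
    (ζ : ℕ → EuclideanSpace ℝ (Fin d) × ℝ) (hK : ∀ i, |(θ i).1| ≤ K)
    (hζ : ∀ k, ∃ m, ζ k = (xs m, ys m))
    (hker : ∀ m m', Tendsto (fun n : ℕ => (n : ℝ)⁻¹ *
      ∑ i ∈ Finset.range n, tangentKernel σ (xs m) (xs m') (θ i)) atTop
      (𝓝 (limitKernel σ μ₀ (xs m) (xs m'))))
    (hcnt : ∀ m, Tendsto (fun n : ℕ => (n : ℝ)⁻¹ *
      ∑ j ∈ Finset.range n, (dataWeight (fun m => (xs m, ys m)) m (ζ j) - 1 / (M : ℝ))) atTop (𝓝 0))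
    (hemp : Tendsto (fun n : ℕ => empiricalMeasure fun i : Fin (n + 1) => θ i) atTop (𝓝 μ₀))
    {ε : ℝ} (hε : 0 < ε) :
    ∀ᶠ n : ℕ in atTop, (∀ m, |netOutput σ (fun i : Fin (n + 1) => θ i) (xs m)| ≤ R) →
      edist (limitPath T σ α xs ys μ₀ (dataOutput σ xs fun i : Fin (n + 1) => θ i))
        (rescaledPath T σ α xs (fun i : Fin (n + 1) => θ i) ζ) ≤ ENNReal.ofReal ε := by
  obtain ⟨Q, hQ0, hQ⟩ := exists_dataOutput_sub_linearFlow_le hM hσ α K R hT xs ys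
    (μ₀ : Measure (ParamSpace d))
  set A := limitOperator σ α (μ₀ : Measure (ParamSpace d)) xs with hA
  set y : EuclideanSpace ℝ (Fin M) := WithLp.toLp 2 ys with hy
  obtain ⟨Cf, hCf0, hCf⟩ := exists_linearFlow_bounds A y T (M * |R|)
  -- Error budget: Q for the training dynamics, Cf for the time gap between t and ⌊Nt⌋/N, and 1 for
  -- the initial empirical measure.
  set η : ℝ := ε / (Q + Cf + 1) with hη
  have hη0 : 0 < η := by positivity
  have hηε : (Q + Cf + 1) * η = ε := by rw [hη]; field_simp
  -- A positive integer above T: the frequency estimate is used at the integer time (n + 1) L with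
  -- tolerance η / L, which covers every k ≤ (n + 1) T with error η (n + 1).
  set L : ℕ := ⌈T⌉₊ + 1 with hL
  have hL0 : (0 : ℝ) < L := by positivity
  have hTL : T ≤ L := by
    rw [hL]
    push_cast
    linarith [Nat.le_ceil T]
  have hsqrt : Tendsto (fun n : ℕ => √((n + 1 : ℕ) : ℝ)) atTop atTop :=
    Real.tendsto_sqrt_atTop.comp (tendsto_natCast_atTop_atTop.comp (tendsto_add_atTop_nat 1))
  have e1 : ∀ᶠ n : ℕ in atTop, Q ≤ √((n + 1 : ℕ) : ℝ) := hsqrt.eventually_ge_atTop Q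
  have e2 : ∀ᶠ n : ℕ in atTop, 1 / √((n + 1 : ℕ) : ℝ) ≤ η :=
    (hsqrt.const_div_atTop 1).eventually_le_const hη0
  have e3 : ∀ᶠ n : ℕ in atTop, ∀ m m', |1 / ((n + 1 : ℕ) : ℝ) *
      ∑ i : Fin (n + 1), tangentKernel σ (xs m) (xs m') (θ i)
        - limitKernel σ μ₀ (xs m) (xs m')| ≤ η := by
    refine eventually_all.2 fun m => eventually_all.2 fun m' => ?_
    have h := ((hker m m').comp (tendsto_add_atTop_nat 1)).sub_const
      (limitKernel σ μ₀ (xs m) (xs m'))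
    rw [sub_self] at h
    have h' := h.abs
    rw [abs_zero] at h'
    filter_upwards [h'.eventually_le_const hη0] with n hn
    rw [Fin.sum_univ_eq_sum_range (fun i => tangentKernel σ (xs m) (xs m') (θ i)), one_div]
    exact hn
  have e4 : ∀ᶠ n : ℕ in atTop, ∀ m, ∀ k : ℕ, (k : ℝ) ≤ ((n + 1 : ℕ) : ℝ) * T →
      |∑ j ∈ Finset.range k, (dataWeight (fun m => (xs m, ys m)) m (ζ j) - 1 / (M : ℝ))|
        ≤ η * ((n + 1 : ℕ) : ℝ) := by
    refine eventually_all.2 fun m => ?_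
    have h := eventually_forall_abs_le_mul (hcnt m) (div_pos hη0 hL0)
    have ht : Tendsto (fun n : ℕ => (n + 1) * L) atTop atTop :=
      (tendsto_add_atTop_nat 1).atTop_mul_const' (by positivity)
    filter_upwards [ht.eventually h] with n hn k hk
    have hkL : k ≤ (n + 1) * L := by
      have : (k : ℝ) ≤ ((n + 1 : ℕ) : ℝ) * L := hk.trans (by gcongr)
      exact_mod_cast this
    refine (hn k hkL).trans (le_of_eq ?_)
    push_cast
    field_simp
  have e5 : ∀ᶠ n : ℕ in atTop, edist (LevyProkhorov.ofMeasure μ₀)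
      (LevyProkhorov.ofMeasure (empiricalMeasure fun i : Fin (n + 1) => θ i)) < ENNReal.ofReal η := by
    have h := (LevyProkhorov.continuous_ofMeasure_probabilityMeasure.tendsto μ₀).comp hemp
    have h2 := EMetric.tendsto_nhds.1 h _ (ENNReal.ofReal_pos.2 hη0)
    filter_upwards [h2] with n hn
    rwa [edist_comm]
  filter_upwards [e1, e2, e3, e4, e5] with n h1 h2 h3 h4 h5 hR
  have hN0 : (0 : ℝ) < ((n + 1 : ℕ) : ℝ) := by positivity
  set θ₀ : Fin (n + 1) → ParamSpace d := fun i => θ i with hθ₀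
  have hmain := hQ η hη0 (n + 1) h1 h2 θ₀ (fun i => hK i) hR ζ hζ h3 h4
  have hg0 : ‖dataOutput σ xs θ₀‖ ≤ M * |R| := by
    have := EuclideanSpace.norm_le_card_mul (v := dataOutput σ xs θ₀) (c := |R|)
      fun m => (hR m).trans (le_abs_self R)
    simpa using this
  have hNinv : 1 / ((n + 1 : ℕ) : ℝ) ≤ η := by
    refine le_trans ?_ h2
    refine one_div_le_one_div_of_le (Real.sqrt_pos.2 hN0) (Real.sqrt_le_iff.2 ⟨hN0.le, ?_⟩)
    push_cast
    nlinarith [(Nat.cast_nonneg n : (0 : ℝ) ≤ n)]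
  refine (SkorokhodSpace.edist_le_iSup _ _).trans (iSup_le fun t => ?_)
  have ht0 : 0 ≤ ((n + 1 : ℕ) : ℝ) * (t : ℝ) := mul_nonneg hN0.le t.2.1
  set k : ℕ := ⌊((n + 1 : ℕ) : ℝ) * (t : ℝ)⌋₊ with hk
  have hkt : (k : ℝ) ≤ ((n + 1 : ℕ) : ℝ) * (t : ℝ) := Nat.floor_le ht0
  have hkt' : ((n + 1 : ℕ) : ℝ) * (t : ℝ) < k + 1 := Nat.lt_floor_add_one _
  have hkT : (k : ℝ) ≤ ((n + 1 : ℕ) : ℝ) * T :=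
    hkt.trans (mul_le_mul_of_nonneg_left t.2.2 hN0.le)
  obtain ⟨m1, m2⟩ := hmain k hkT
  rw [Prod.edist_eq]
  refine max_le ?_ ?_
  · show edist (LevyProkhorov.ofMeasure μ₀)
      (LevyProkhorov.ofMeasure (empiricalMeasure (sgd σ α θ₀ ζ k))) ≤ ENNReal.ofReal ε
    refine (edist_triangle _ (LevyProkhorov.ofMeasure (empiricalMeasure θ₀)) _).trans ?_
    have h6 : edist (LevyProkhorov.ofMeasure (empiricalMeasure θ₀))
        (LevyProkhorov.ofMeasure (empiricalMeasure (sgd σ α θ₀ ζ k))) ≤ ENNReal.ofReal (Q * η) := by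
      refine (edist_ofMeasure_empiricalMeasure_le _ _).trans (edist_pi_le_iff.2 fun i => ?_)
      rw [edist_comm, edist_dist, dist_eq_norm]
      exact ENNReal.ofReal_le_ofReal (m1 i)
    refine (add_le_add h5.le h6).trans ?_
    rw [← ENNReal.ofReal_add hη0.le (by positivity)]
    refine ENNReal.ofReal_le_ofReal ?_
    nlinarith
  · show edist (linearFlow A y (dataOutput σ xs θ₀) t) (dataOutput σ xs (sgd σ α θ₀ ζ k)) ≤
      ENNReal.ofReal ε
    rw [edist_dist, dist_eq_norm]
    refine ENNReal.ofReal_le_ofReal ?_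
    have hkn : (k : ℝ) / ((n + 1 : ℕ) : ℝ) ≤ t := by
      rw [div_le_iff₀ hN0, mul_comm]
      exact hkt
    have h6 := (hCf _ hg0 (k / ((n + 1 : ℕ) : ℝ)) ⟨by positivity, hkn.trans t.2.2⟩ t t.2 hkn).1
    have h7 : (t : ℝ) - k / ((n + 1 : ℕ) : ℝ) ≤ 1 / ((n + 1 : ℕ) : ℝ) := by
      rw [sub_le_iff_le_add, ← add_div, le_div_iff₀ hN0]
      linarith
    have h8 : Cf * ((t : ℝ) - k / ((n + 1 : ℕ) : ℝ)) ≤ Cf * η :=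
      mul_le_mul_of_nonneg_left (h7.trans hNinv) hCf0
    rw [← norm_neg, neg_sub] at m2
    calc _ = ‖(linearFlow A y (dataOutput σ xs θ₀) t
            - linearFlow A y (dataOutput σ xs θ₀) (k / ((n + 1 : ℕ) : ℝ)))
          + (linearFlow A y (dataOutput σ xs θ₀) (k / ((n + 1 : ℕ) : ℝ))
            - dataOutput σ xs (sgd σ α θ₀ ζ k))‖ := by rw [sub_add_sub_cancel]
      _ ≤ Cf * η + Q * η := (norm_add_le _ _).trans (add_le_add (h6.trans h8) m2)
      _ ≤ ε := by nlinarith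

end Pathwise

/-! ### The initial law -/

section InitialLaw

variable {d M : ℕ} {σ : ℝ → ℝ} {μ : Measure (ParamSpace d)} [IsProbabilityMeasure μ]

theorem integrable_tangentKernel_aux (hσ : IsCb2 σ) {K : ℝ} (hK : ∀ᵐ p ∂μ, |p.1| ≤ K)
    (x x' : EuclideanSpace ℝ (Fin d)) :
    Integrable (fun p : ParamSpace d => σ ⟪p.2, x⟫ * σ ⟪p.2, x'⟫) μ ∧
    Integrable (fun p : ParamSpace d =>
      p.1 ^ 2 * deriv σ ⟪p.2, x'⟫ * deriv σ ⟪p.2, x⟫ * ⟪x, x'⟫) μ := by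
  obtain ⟨B, hB0, hd, hc1, hb, hb1, -, -⟩ := hσ.exists_bounds
  have hc := hd.continuous
  constructor
  · refine Integrable.of_bound (by fun_prop) (B * B) (Eventually.of_forall fun p => ?_)
    rw [Real.norm_eq_abs, abs_mul]
    exact mul_le_mul (hb _) (hb _) (abs_nonneg _) hB0
  · refine Integrable.of_bound (by fun_prop) (K ^ 2 * B * B * |⟪x, x'⟫|) ?_
    filter_upwards [hK] with p hp
    have hK0 : 0 ≤ K := (abs_nonneg _).trans hp
    have h1 := hb1 ⟪p.2, x⟫
    have h2 := hb1 ⟪p.2, x'⟫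
    rw [Real.norm_eq_abs, abs_mul, abs_mul, abs_mul, abs_pow]
    gcongr

theorem integral_tangentKernel (hσ : IsCb2 σ) {K : ℝ} (hK : ∀ᵐ p ∂μ, |p.1| ≤ K)
    (x x' : EuclideanSpace ℝ (Fin d)) :
    ∫ p, tangentKernel σ x x' p ∂μ = limitKernel σ μ x x' :=
  integral_add (integrable_tangentKernel_aux hσ hK x x').1
    (integrable_tangentKernel_aux hσ hK x x').2

theorem integrable_tangentKernel (hσ : IsCb2 σ) {K : ℝ} (hK : ∀ᵐ p ∂μ, |p.1| ≤ K)
    (x x' : EuclideanSpace ℝ (Fin d)) : Integrable (tangentKernel σ x x') μ :=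
  (integrable_tangentKernel_aux hσ hK x x').1.add (integrable_tangentKernel_aux hσ hK x x').2

theorem measurable_tangentKernel (hσ : IsCb2 σ) (x x' : EuclideanSpace ℝ (Fin d)) :
    Measurable (tangentKernel σ x x') := by
  obtain ⟨B, hB0, hd, hc1, -⟩ := hσ.exists_bounds
  have hc := hd.continuous
  unfold tangentKernel
  fun_prop

/-- The vector of the contributions `c σ(w · x⁽ᵐ⁾)` of one hidden unit. -/
noncomputable def unitOutput (σ : ℝ → ℝ) (xs : Fin M → EuclideanSpace ℝ (Fin d)) (p : ParamSpace d) :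
    EuclideanSpace ℝ (Fin M) := WithLp.toLp 2 fun m => p.1 * σ ⟪p.2, xs m⟫

theorem continuous_unitOutput (hσ : Continuous σ) (xs : Fin M → EuclideanSpace ℝ (Fin d)) :
    Continuous (unitOutput σ xs) := by
  unfold unitOutput
  fun_prop

theorem memLp_unitOutput (hσ : IsCb2 σ) {K : ℝ} (hK : ∀ᵐ p ∂μ, |p.1| ≤ K)
    (xs : Fin M → EuclideanSpace ℝ (Fin d)) : MemLp (unitOutput σ xs) 2 μ := by
  obtain ⟨B, hB0, hd, hc1, hb, -⟩ := hσ.exists_bounds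
  refine MemLp.of_bound (continuous_unitOutput hd.continuous xs).aestronglyMeasurable (M * (K * B)) ?_
  filter_upwards [hK] with p hp
  have := EuclideanSpace.norm_le_card_mul (v := unitOutput σ xs p) (c := K * B) fun m => by
    show |p.1 * σ ⟪p.2, xs m⟫| ≤ K * B
    rw [abs_mul]
    exact mul_le_mul hp (hb _) (abs_nonneg _) ((abs_nonneg _).trans hp)
  simpa using this

omit [IsProbabilityMeasure μ] in
theorem integral_unitOutput_mul (xs : Fin M → EuclideanSpace ℝ (Fin d)) (m m' : Fin M) :
    ∫ p, unitOutput σ xs p m * unitOutput σ xs p m' ∂μ = initialCovariance σ μ xs m m' := by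
  rw [initialCovariance, Matrix.of_apply]
  congr 1
  ext p
  simp only [unitOutput]
  ring

/-- A Gram matrix in L²(μ): its quadratic form at v is the integral of the square of ∑ v_m c σ(⟪w,
x_m⟫). -/
theorem posSemidef_initialCovariance (hσ : IsCb2 σ) {K : ℝ} (hK : ∀ᵐ p ∂μ, |p.1| ≤ K)
    (xs : Fin M → EuclideanSpace ℝ (Fin d)) : (initialCovariance σ μ xs).PosSemidef := by
  have hL : ∀ m, MemLp (fun p => unitOutput σ xs p m) 2 μ := fun m =>
    (EuclideanSpace.proj (𝕜 := ℝ) m).comp_memLp' (memLp_unitOutput hσ hK xs)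
  refine Matrix.PosSemidef.of_dotProduct_mulVec_nonneg ?_ fun v => ?_
  · ext m m'
    rw [Matrix.conjTranspose_apply, star_trivial, ← integral_unitOutput_mul,
      ← integral_unitOutput_mul]
    simp only [mul_comm]
  · have e : star v ⬝ᵥ (initialCovariance σ μ xs).mulVec v =
        ∫ p, (∑ m, v m * unitOutput σ xs p m) ^ 2 ∂μ := by
      have hint : ∀ m m', Integrable (fun p => v m * v m' *
          (unitOutput σ xs p m * unitOutput σ xs p m')) μ := fun m m' =>
        ((hL m).integrable_mul (hL m')).const_mul _
      have h1 : ∀ p, (∑ m, v m * unitOutput σ xs p m) ^ 2 =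
          ∑ m, ∑ m', v m * v m' * (unitOutput σ xs p m * unitOutput σ xs p m') := by
        intro p
        rw [sq, Finset.sum_mul_sum]
        exact Finset.sum_congr rfl fun _ _ => Finset.sum_congr rfl fun _ _ => by ring
      simp only [h1]
      rw [integral_finsetSum _ fun m _ => integrable_finsetSum _ fun m' _ => hint m m']
      simp only [dotProduct, Matrix.mulVec, Finset.mul_sum, star_trivial]
      refine Finset.sum_congr rfl fun m _ => ?_
      rw [integral_finsetSum _ fun m' _ => hint m m']
      refine Finset.sum_congr rfl fun m' _ => ?_
      rw [integral_const_mul, integral_unitOutput_mul]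
      ring
    rw [e]
    exact integral_nonneg fun p => sq_nonneg _

theorem dataOutput_eq_smul_sum (xs : Fin M → EuclideanSpace ℝ (Fin d)) (θ : ℕ → ParamSpace d)
    (n : ℕ) : dataOutput σ xs (fun i : Fin n => θ i) =
      (√(n : ℝ))⁻¹ • ∑ i ∈ Finset.range n, unitOutput σ xs (θ i) := by
  ext m
  simp only [dataOutput, netOutput, unitOutput, one_div, PiLp.smul_apply, WithLp.ofLp_sum,
    Finset.sum_apply, smul_eq_mul]
  rw [Fin.sum_univ_eq_sum_range fun i => (θ i).1 * σ ⟪(θ i).2, xs m⟫]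

theorem tendstoInDistribution_dataOutput (hσ : IsCb2 σ) {K : ℝ} (hK : ∀ᵐ p ∂μ, |p.1| ≤ K)
    (xs : Fin M → EuclideanSpace ℝ (Fin d))
    (hzero : ∀ m, ∫ p, p.1 * σ ⟪p.2, xs m⟫ ∂μ = 0)
    {Ω : Type*} [MeasurableSpace Ω] (P : Measure Ω) [IsProbabilityMeasure P]
    {θ₀ : ℕ → Ω → ParamSpace d} (hθ₀ : ∀ i, Measurable (θ₀ i)) (hlaw : ∀ i, P.map (θ₀ i) = μ)
    (hindep : iIndepFun θ₀ P) {Ω' : Type*} [MeasurableSpace Ω'] (P' : Measure Ω')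
    [IsProbabilityMeasure P'] {G : Ω' → EuclideanSpace ℝ (Fin M)} (hG : Measurable G)
    (hGlaw : P'.map G = multivariateGaussian 0 (initialCovariance σ μ xs)) :
    TendstoInDistribution
      (fun (n : ℕ) ω => dataOutput σ xs fun i : Fin (n + 1) => θ₀ i ω) atTop G (fun _ => P) P' := by
  obtain ⟨B, hB0, hd, -⟩ := hσ.exists_bounds
  have hc := continuous_unitOutput hd.continuous xs
  have hm : ∀ i, AEStronglyMeasurable (fun p => unitOutput σ xs p i) μ := fun i =>
    ((EuclideanSpace.proj (𝕜 := ℝ) i).continuous.comp hc).aestronglyMeasurable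
  have hmap : ∀ φ : ParamSpace d → ℝ, AEStronglyMeasurable φ μ →
      ∫ ω, φ (θ₀ 0 ω) ∂P = ∫ p, φ p ∂μ := fun φ hφ => by
    rw [← hlaw 0] at hφ ⊢
    exact (integral_map (hθ₀ 0).aemeasurable hφ).symm
  have hLp : MemLp (unitOutput σ xs ∘ θ₀ 0) 2 P := by
    have h := memLp_unitOutput hσ hK xs
    rw [← hlaw 0] at h
    exact (memLp_map_measure_iff hc.aestronglyMeasurable (hθ₀ 0).aemeasurable).1 h
  have hident : ∀ i, IdentDistrib (unitOutput σ xs ∘ θ₀ i) (unitOutput σ xs ∘ θ₀ 0) P P :=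
    fun i => IdentDistrib.comp
      ⟨(hθ₀ i).aemeasurable, (hθ₀ 0).aemeasurable, by rw [hlaw, hlaw]⟩ hc.measurable
  have clt := tendstoInDistribution_multivariate_clt (P := P) (P' := P')
    (X := fun i ω => unitOutput σ xs (θ₀ i ω)) (posSemidef_initialCovariance hσ hK xs)
    hLp
    (fun m => (hmap _ (hm m)).trans (hzero m))
    (fun m m' => (hmap _ ((hm m).mul (hm m'))).trans (integral_unitOutput_mul xs m m'))
    (hindep.comp (fun _ => unitOutput σ xs) fun _ => hc.measurable)
    hident hG.aemeasurable hGlaw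
  have clt' : TendstoInDistribution (fun (n : ℕ) ω => (√((n + 1 : ℕ) : ℝ))⁻¹ •
      ∑ i ∈ Finset.range (n + 1), unitOutput σ xs (θ₀ i ω)) atTop G (fun _ => P) P' :=
    ⟨fun n => clt.forall_aemeasurable (n + 1), clt.aemeasurable_limit,
      clt.tendsto.comp (tendsto_add_atTop_nat 1)⟩
  convert clt' using 3 with n ω
  exact dataOutput_eq_smul_sum xs (fun i => θ₀ i ω) (n + 1)

end InitialLaw

/-! ### The law of the samples -/

section Samples

variable {d M : ℕ}

theorem ae_dataMeasure (xs : Fin M → EuclideanSpace ℝ (Fin d)) (ys : Fin M → ℝ) :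
    ∀ᵐ p ∂(dataMeasure xs ys), ∃ m, p = (xs m, ys m) := by
  rw [ae_iff]
  have hs : MeasurableSet {p : EuclideanSpace ℝ (Fin d) × ℝ | ¬ ∃ m, p = (xs m, ys m)} := by
    have : {p : EuclideanSpace ℝ (Fin d) × ℝ | ¬ ∃ m, p = (xs m, ys m)} =
        (Set.range fun m => (xs m, ys m))ᶜ := by
      ext p
      simp [eq_comm]
    rw [this]
    exact (Set.finite_range _).measurableSet.compl
  simp only [dataMeasure, Measure.smul_apply, Measure.finsetSum_apply, smul_eq_mul]
  rw [Finset.sum_eq_zero, mul_zero]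
  intro m _
  rw [Measure.dirac_apply' _ hs, Set.indicator_of_notMem]
  exact fun h => h ⟨m, rfl⟩

theorem measurable_dataWeight {ι D : Type*} [Fintype ι] [MeasurableSpace D]
    [MeasurableSingletonClass D] (pt : ι → D) (m : ι) : Measurable (dataWeight pt m) := by
  classical
  unfold dataWeight
  refine Measurable.ite ?_ measurable_const measurable_const
  have : {p | pt m = p} = {pt m} := by
    ext p
    simp [eq_comm]
  rw [this]
  exact measurableSet_singleton _

theorem integral_dataWeight (xs : Fin M → EuclideanSpace ℝ (Fin d)) (ys : Fin M → ℝ) (m : Fin M) :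
    ∫ p, dataWeight (fun m => (xs m, ys m)) m p ∂(dataMeasure xs ys) = 1 / (M : ℝ) := by
  have hm := (measurable_dataWeight (fun m => (xs m, ys m)) m).stronglyMeasurable
  rw [dataMeasure, integral_smul_measure, integral_finsetSum_measure]
  · simp only [integral_dirac' _ _ hm, sum_dataWeight (fun m => (xs m, ys m)) m]
    simp
  · intro m' _
    exact integrable_dirac' hm (by simp)

end Samples

/-! ### Convergence in distribution of the rescaled paths -/

/-- If `D n ≤ ε` eventually almost surely on each event `‖g n‖ ≤ R`, and `g n` converges in
distribution, then `D n → 0` in probability. -/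
theorem tendsto_measure_ge_of_eventually_le_on_bounded {Ω Ω' V : Type*} [MeasurableSpace Ω]
    [MeasurableSpace Ω'] [NormedAddCommGroup V] [MeasurableSpace V] [BorelSpace V]
    {P : Measure Ω} [IsProbabilityMeasure P] {P' : Measure Ω'} [IsProbabilityMeasure P']
    {g : ℕ → Ω → V} {G : Ω' → V} (hg : TendstoInDistribution g atTop G (fun _ => P) P')
    (hgm : ∀ n, Measurable (g n)) {D : ℕ → Ω → ℝ≥0∞} (hD : ∀ n, Measurable (D n))
    (h : ∀ᵐ ω ∂P, ∀ R : ℕ, ∀ ε : ℝ, 0 < ε → ∀ᶠ n in atTop, ‖g n ω‖ ≤ R → D n ω ≤ ENNReal.ofReal ε)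
    {ε : ℝ≥0∞} (hε : 0 < ε) : Tendsto (fun n => P {ω | ε ≤ D n ω}) atTop (𝓝 0) := by
  -- A finite δ strictly between 0 and ε: ε may be infinite, and strictness excludes ε ≤ D n once D
  -- n ≤ δ.
  obtain ⟨δ, hδ0, hδε⟩ := ENNReal.lt_iff_exists_nnreal_btwn.1 hε
  have hδ : (0 : ℝ) < δ := by exact_mod_cast hδ0
  -- On ‖g n‖ ≤ R the event ε ≤ D n has vanishing probability by almost sure convergence of
  -- indicators; the rest is a tail of g n, controlled by the portmanteau theorem. Then R → ∞.
  have key : ∀ R : ℕ, limsup (fun n => P {ω | ε ≤ D n ω}) atTop ≤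
      (P'.map G) {v | (R : ℝ) ≤ ‖v‖} := by
    intro R
    have hcl : IsClosed {v : V | (R : ℝ) ≤ ‖v‖} := isClosed_le continuous_const continuous_norm
    have hA : Tendsto (fun n => P {ω | ‖g n ω‖ ≤ R ∧ ε ≤ D n ω}) atTop (𝓝 (P ∅)) := by
      refine tendsto_measure_of_ae_tendsto_indicator_of_isFiniteMeasure atTop MeasurableSet.empty
        (fun n => ?_) ?_
      · exact (measurableSet_le (hgm n).norm measurable_const).inter
          (measurableSet_le measurable_const (hD n))
      · filter_upwards [h] with ω hω
        filter_upwards [hω R δ hδ] with n hn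
        simp only [Set.mem_empty_iff_false, iff_false, not_and, not_le]
        intro hR
        refine (hn hR).trans_lt ?_
        rwa [ENNReal.ofReal_coe_nnreal]
    rw [measure_empty] at hA
    have h1 : ∀ n, P {ω | ε ≤ D n ω} ≤ P {ω | ‖g n ω‖ ≤ R ∧ ε ≤ D n ω}
        + (P.map (g n)) {v | (R : ℝ) ≤ ‖v‖} := by
      intro n
      rw [Measure.map_apply (hgm n) hcl.measurableSet]
      refine (measure_mono fun ω hω => ?_).trans (measure_union_le _ _)
      rcases le_total ‖g n ω‖ R with hR | hR
      · exact Or.inl ⟨hR, hω⟩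
      · exact Or.inr hR
    refine (limsup_le_limsup (Eventually.of_forall h1)).trans ?_
    refine (ENNReal.limsup_add_of_left_tendsto_zero hA _).trans_le ?_
    exact ProbabilityMeasure.limsup_measure_closed_le_of_tendsto hg.tendsto hcl
  have hlim : Tendsto (fun R : ℕ => (P'.map G) {v | (R : ℝ) ≤ ‖v‖}) atTop (𝓝 0) := by
    have := Measure.isProbabilityMeasure_map hg.aemeasurable_limit
    have h2 := tendsto_measure_iInter_atTop (μ := P'.map G)
      (s := fun R : ℕ => {v : V | (R : ℝ) ≤ ‖v‖})
      (fun R => (isClosed_le continuous_const continuous_norm).measurableSet.nullMeasurableSet)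
      (fun R S hRS v (hv : (S : ℝ) ≤ ‖v‖) => (Nat.cast_le.2 hRS).trans hv) ⟨0, measure_ne_top _ _⟩
    have h3 : (⋂ R : ℕ, {v : V | (R : ℝ) ≤ ‖v‖}) = ∅ := by
      refine Set.eq_empty_of_forall_notMem fun v hv => ?_
      obtain ⟨R, hR⟩ := exists_nat_gt ‖v‖
      exact absurd (Set.mem_iInter.1 hv R) (not_le.2 hR)
    rwa [h3, measure_empty] at h2
  have h0 : limsup (fun n => P {ω | ε ≤ D n ω}) atTop ≤ 0 :=
    ge_of_tendsto hlim (Eventually.of_forall key)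
  exact tendsto_of_le_liminf_of_limsup_le bot_le h0

section Final

variable {d M : ℕ} {σ : ℝ → ℝ} {μ₀ : ProbabilityMeasure (ParamSpace d)}
  {xs : Fin M → EuclideanSpace ℝ (Fin d)} {ys : Fin M → ℝ} {Ω : Type*} [MeasurableSpace Ω]
  {P : Measure Ω} [IsProbabilityMeasure P] {θ₀ : ℕ → Ω → ParamSpace d}
  {ζ : ℕ → Ω → EuclideanSpace ℝ (Fin d) × ℝ}

theorem ae_eventually_edist_limitPath_rescaledPath_le (hM : 0 < M) {T : ℝ} (hT : 0 ≤ T) (α : ℝ)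
    (hσ : IsCb2 σ) {K : ℝ} (hK : ∀ᵐ p ∂(μ₀ : Measure (ParamSpace d)), |p.1| ≤ K)
    (hθ₀ : ∀ i, Measurable (θ₀ i)) (hθ₀law : ∀ i, P.map (θ₀ i) = (μ₀ : Measure (ParamSpace d)))
    (hθ₀indep : iIndepFun θ₀ P) (hζ : ∀ k, Measurable (ζ k))
    (hζlaw : ∀ k, P.map (ζ k) = dataMeasure xs ys) (hζindep : iIndepFun ζ P) :
    ∀ᵐ ω ∂P, ∀ R : ℕ, ∀ ε : ℝ, 0 < ε → ∀ᶠ n : ℕ in atTop,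
      ‖dataOutput σ xs (fun i : Fin (n + 1) => θ₀ i ω)‖ ≤ R →
      edist (limitPath T σ α xs ys μ₀ (dataOutput σ xs fun i : Fin (n + 1) => θ₀ i ω))
        (rescaledPath (N := n + 1) T σ α xs (fun i => θ₀ i ω) fun k => ζ k ω) ≤
        ENNReal.ofReal ε := by
  have hKae : ∀ᵐ ω ∂P, ∀ i, |(θ₀ i ω).1| ≤ K := by
    refine ae_all_iff.2 fun i => ?_
    rw [← hθ₀law i] at hK
    exact ae_of_ae_map (hθ₀ i).aemeasurable hK
  have hζae : ∀ᵐ ω ∂P, ∀ k, ∃ m, ζ k ω = (xs m, ys m) := by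
    refine ae_all_iff.2 fun k => ?_
    have h := ae_dataMeasure xs ys
    rw [← hζlaw k] at h
    exact ae_of_ae_map (hζ k).aemeasurable h
  have hkerae : ∀ᵐ ω ∂P, ∀ m m', Tendsto (fun n : ℕ => (n : ℝ)⁻¹ *
      ∑ i ∈ Finset.range n, tangentKernel σ (xs m) (xs m') (θ₀ i ω)) atTop
      (𝓝 (limitKernel σ μ₀ (xs m) (xs m'))) := by
    refine ae_all_iff.2 fun m => ae_all_iff.2 fun m' => ?_
    have h := ae_tendsto_average_comp hθ₀ hθ₀law hθ₀indep
      (measurable_tangentKernel hσ (xs m) (xs m')) (integrable_tangentKernel hσ hK _ _)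
    rwa [integral_tangentKernel hσ hK] at h
  have hcntae : ∀ᵐ ω ∂P, ∀ m, Tendsto (fun n : ℕ => (n : ℝ)⁻¹ * ∑ j ∈ Finset.range n,
      (dataWeight (fun m => (xs m, ys m)) m (ζ j ω) - 1 / (M : ℝ))) atTop (𝓝 0) := by
    refine ae_all_iff.2 fun m => ?_
    have hprob : IsProbabilityMeasure (dataMeasure xs ys) := by
      rw [← hζlaw 0]
      exact Measure.isProbabilityMeasure_map (hζ 0).aemeasurable
    have hw := measurable_dataWeight (fun m => (xs m, ys m)) m
    have hwint : Integrable (dataWeight (fun m => (xs m, ys m)) m) (dataMeasure xs ys) := by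
      -- A non-integrable function would have integral 0 by convention, whereas this integral is 1/M
      -- > 0.
      by_contra hni
      have h1 := integral_dataWeight xs ys m
      rw [integral_undef hni] at h1
      have : (0 : ℝ) < 1 / M := by positivity
      exact this.ne h1
    have h := ae_tendsto_average_comp hζ hζlaw hζindep
      (φ := fun p => dataWeight (fun m => (xs m, ys m)) m p - 1 / (M : ℝ))
      (hw.sub_const _) (hwint.sub (integrable_const _))
    rw [integral_sub hwint (integrable_const _), integral_dataWeight] at h
    simpa using h
  filter_upwards [hKae, hζae, hkerae, hcntae, ae_tendsto_empiricalMeasure hθ₀ hθ₀law hθ₀indep]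
    with ω h1 h2 h3 h4 h5 R ε hε
  filter_upwards [eventually_edist_limitPath_rescaledPath_le hM hσ α K R hT xs ys μ₀
    (fun i => θ₀ i ω) (fun k => ζ k ω) h1 h2 h3 h4 h5 hε] with n hn hR
  exact hn fun m => (EuclideanSpace.abs_apply_le_norm _ m).trans hR

/-- Continuity in the parameters and samples gives measurability of this distance directly, without
joint measurability of the metric on path space. -/
theorem continuous_edist_limitPath_rescaledPath {N : ℕ} [NeZero N] (T : ℝ) (hσ : Continuous σ)
    (hσ' : Continuous (deriv σ)) (α : ℝ) (ys : Fin M → ℝ) :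
    Continuous fun q : (Fin N → ParamSpace d) × (ℕ → EuclideanSpace ℝ (Fin d) × ℝ) =>
      edist (limitPath T σ α xs ys μ₀ (dataOutput σ xs q.1)) (rescaledPath T σ α xs q.1 q.2) :=
  Continuous.edist (f := fun q : (Fin N → ParamSpace d) × (ℕ → EuclideanSpace ℝ (Fin d) × ℝ) =>
      limitPath T σ α xs ys μ₀ (dataOutput σ xs q.1))
    (g := fun q => rescaledPath T σ α xs q.1 q.2)
    ((continuous_limitPath σ α xs ys μ₀).comp ((continuous_dataOutput hσ xs).comp continuous_fst))
    (continuous_rescaledPath T hσ hσ' α xs)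

theorem tendstoInDistribution_rescaledPath (hM : 0 < M) {T : ℝ} (hT : 0 ≤ T) (α : ℝ)
    (hσ : IsCb2 σ) {K : ℝ} (hK : ∀ᵐ p ∂(μ₀ : Measure (ParamSpace d)), |p.1| ≤ K)
    (hzero : ∀ m, ∫ p, p.1 * σ ⟪p.2, xs m⟫ ∂(μ₀ : Measure (ParamSpace d)) = 0)
    (hθ₀ : ∀ i, Measurable (θ₀ i)) (hθ₀law : ∀ i, P.map (θ₀ i) = (μ₀ : Measure (ParamSpace d)))
    (hθ₀indep : iIndepFun θ₀ P) (hζ : ∀ k, Measurable (ζ k))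
    (hζlaw : ∀ k, P.map (ζ k) = dataMeasure xs ys) (hζindep : iIndepFun ζ P)
    {Ω' : Type*} [MeasurableSpace Ω'] {P' : Measure Ω'} [IsProbabilityMeasure P']
    {G : Ω' → EuclideanSpace ℝ (Fin M)} (hG : Measurable G)
    (hGlaw : P'.map G = multivariateGaussian 0 (initialCovariance σ μ₀ xs)) :
    TendstoInDistribution
      (fun (n : ℕ) ω => rescaledPath (N := n + 1) T σ α xs (fun i => θ₀ i ω) fun k => ζ k ω)
      atTop (fun ω => limitPath T σ α xs ys μ₀ (G ω)) (fun _ => P) P' := by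
  obtain ⟨B, -, hd, hσ', -⟩ := hσ.exists_bounds
  have hσc := hd.continuous
  have hq : ∀ n : ℕ, Measurable fun ω =>
      ((fun i : Fin (n + 1) => θ₀ i ω, fun k => ζ k ω) :
        (Fin (n + 1) → ParamSpace d) × (ℕ → EuclideanSpace ℝ (Fin d) × ℝ)) := fun n =>
    (measurable_pi_lambda (fun ω (i : Fin (n + 1)) => θ₀ i ω) fun i => hθ₀ i).prodMk (measurable_pi_lambda _ fun k => hζ k)
  have hX := tendstoInDistribution_dataOutput hσ hK xs hzero P hθ₀ hθ₀law hθ₀indep P' hG hGlaw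
  have hgm : ∀ n : ℕ, Measurable fun ω => dataOutput σ xs fun i : Fin (n + 1) => θ₀ i ω :=
    fun n => ((continuous_dataOutput hσc xs).comp continuous_fst).measurable.comp (hq n)
  refine tendstoInDistribution_of_tendsto_measure_edist
    (hX.continuous_comp (continuous_limitPath (T := T) σ α xs ys μ₀)) (fun n => ?_)
    fun ε hε => ?_
  · exact ((continuous_rescaledPath T hσc hσ' α xs).measurable.comp (hq n)).aemeasurable
  · refine tendsto_measure_ge_of_eventually_le_on_bounded hX hgm (fun n => ?_)
      (ae_eventually_edist_limitPath_rescaledPath_le hM hT α hσ hK hθ₀ hθ₀law hθ₀indep hζ hζlaw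
        hζindep) hε
    have hm := (continuous_edist_limitPath_rescaledPath (N := n + 1) (μ₀ := μ₀) (xs := xs) T hσc
      hσ' α ys).measurable.comp (hq n)
    exact hm

end Final

/-! ### The main theorem -/

theorem theorem1 {d M : ℕ} (hM : 0 < M) {T : ℝ} (hT : 0 < T) (α : ℝ)
    (σ : ℝ → ℝ) (hσ : IsCb2 σ)
    (μ₀ : ProbabilityMeasure (ParamSpace d))
    (hμ₀c : ∃ K : ℝ, ∀ᵐ p ∂(μ₀ : Measure (ParamSpace d)), |p.1| ≤ K)
    (hμ₀w : Integrable (fun p => ‖p.2‖) (μ₀ : Measure (ParamSpace d)))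
    (xs : Fin M → EuclideanSpace ℝ (Fin d)) (ys : Fin M → ℝ)
    (hμ₀zero : ∀ m, ∫ p, p.1 * σ ⟪p.2, xs m⟫ ∂(μ₀ : Measure (ParamSpace d)) = 0)
    {Ω : Type*} [MeasurableSpace Ω] (P : Measure Ω) [IsProbabilityMeasure P]
    (θ₀ : ℕ → Ω → ParamSpace d) (hθ₀ : ∀ i, Measurable (θ₀ i))
    (hθ₀law : ∀ i, P.map (θ₀ i) = (μ₀ : Measure (ParamSpace d))) (hθ₀indep : iIndepFun θ₀ P)
    (ζ : ℕ → Ω → EuclideanSpace ℝ (Fin d) × ℝ) (hζ : ∀ k, Measurable (ζ k))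
    (hζlaw : ∀ k, P.map (ζ k) = dataMeasure xs ys) (hζindep : iIndepFun ζ P)
    (hindep : IndepFun (fun ω i => θ₀ i ω) (fun ω k => ζ k ω) P)
    {Ω' : Type*} [MeasurableSpace Ω'] (P' : Measure Ω') [IsProbabilityMeasure P']
    (G : Ω' → EuclideanSpace ℝ (Fin M)) (hG : Measurable G)
    (hGlaw : P'.map G = multivariateGaussian 0 (initialCovariance σ μ₀ xs)) :
    (initialCovariance σ (μ₀ : Measure (ParamSpace d)) xs).PosSemidef ∧
    TendstoInDistribution
      (fun (n : ℕ) ω => dataOutput σ xs fun i : Fin (n + 1) => θ₀ i ω) atTop G (fun _ => P) P' ∧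
    ∃ Z : Ω' → SkorokhodSpace T (StateSpace d M),
      (∀ ω, IsLimitSolution hT.le σ α xs ys μ₀ (G ω) (Z ω)) ∧
      (∀ ω z, IsLimitSolution hT.le σ α xs ys μ₀ (G ω) z → z = Z ω) ∧
      (∀ ω, ∀ t ∈ Set.Icc (0 : ℝ) T, ((Z ω).eval hT.le t).1.toMeasure = μ₀) ∧
      (∀ ω, ((Z ω).eval hT.le 0).2 = G ω) ∧
      (∀ ω, ∀ t ∈ Set.Icc (0 : ℝ) T, ∀ m : Fin M,
        HasDerivWithinAt (fun s => ((Z ω).eval hT.le s).2 m)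
          (∑ m' : Fin M, limitMatrix σ α μ₀ xs m m' * (ys m' - ((Z ω).eval hT.le t).2 m'))
          (Set.Icc 0 T) t) ∧
      TendstoInDistribution
        (fun (n : ℕ) ω => rescaledPath (N := n + 1) T σ α xs (fun i => θ₀ i ω) fun k => ζ k ω)
        atTop Z (fun _ => P) P' := by
  obtain ⟨K, hK⟩ := hμ₀c
  refine ⟨posSemidef_initialCovariance hσ hK xs,
    tendstoInDistribution_dataOutput hσ hK xs hμ₀zero P hθ₀ hθ₀law hθ₀indep P' hG hGlaw,
    fun ω => limitPath T σ α xs ys μ₀ (G ω),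
    fun ω => isLimitSolution_limitPath hT.le σ α xs ys μ₀ (G ω),
    fun ω z hz => hz.eq_limitPath,
    fun ω t _ => limitPath_eval_fst hT.le σ α xs ys μ₀ (G ω) t, fun ω => ?_, fun ω t ht m => ?_,
    tendstoInDistribution_rescaledPath hM hT.le α hσ hK hμ₀zero hθ₀ hθ₀law hθ₀indep hζ hζlaw
      hζindep hG hGlaw⟩
  · rw [limitPath_eval_snd hT.le _ _ _ _ _ _ ⟨le_rfl, hT.le⟩, linearFlow_zero]
  · rw [limitPath_eval_snd hT.le _ _ _ _ _ _ ht]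
    refine (hasDerivAt_linearFlow_apply σ α μ₀ xs ys (G ω) t m).hasDerivWithinAt.congr
      (fun s hs => ?_) ?_
    · rw [limitPath_eval_snd hT.le _ _ _ _ _ _ hs]
    · rw [limitPath_eval_snd hT.le _ _ _ _ _ _ ht]
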